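/- Let $(\Sigma,\partial)$ be a differential field of characteristic $0$ whose field of constants $\mathbf C$ is algebraically closed, and let $\Sigma[\partial]$ be the ring of ordinary differential operators over $\Sigma$, with $\partial a=a\partial+a'$. Let $L\in\Sigma[\partial]\setminus\mathbf C[\partial]$ be an operator of order $3$ with nontrivial centralizer $\mathcal Z(L)=\{A\in\Sigma[\partial] : LA=AL\}$, that is, $\mathbf C[L]\subsetneq\mathcal Z(L)\subsetneq\Sigma[\partial]$. Then $\mathcal Z(L)$ has a basis of the form $\{1,A_1,A_2\}$ as a $\mathbf C[L]$-module. Let $\{1,A_1,A_2\}$ be any such basis, let $\mathrm{BC}(L)=\{g\in\mathbf C[\lambda,\mu_1,\mu_2] : g(L,A_1,A_2)=0\}$ (the ideal of the spectral curve $\Gamma$ of $L$), and let $[\mathrm{BC}(L)]$ be the differential ideal that it generates in $\Sigma[\lambda,\mu_1,\mu_2]$, where $\partial\lambda=\partial\mu_1=\partial\mu_2=0$. Then $[\mathrm{BC}(L)]$ is a prime ideal. Let $\Sigma(\Gamma)$ be the fraction field of $\Sigma[\lambda,\mu_1,\mu_2]/[\mathrm{BC}(L)]$, with the induced derivation. There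 is $\phi\in\Sigma(\Gamma)$ with the following properties. 1. $\partial+\phi$ is a right factor of $L-\lambda$ in $\Sigma(\Gamma)[\partial]$: $L-\lambda=N\cdot(\partial+\phi)$ for some $N\in\Sigma(\Gamma)[\partial]$. 2. $\partial+\phi$ is the monic greatest common right divisor $\mathrm{gcrd}(L-\lambda,A_1-\mu_1,A_2-\mu_2)$ in $\Sigma(\Gamma)[\partial]$. 3. The factor does not depend on the basis: if $\{1,B_1,B_2\}$ is any basis of $\mathcal Z(L)$ as a $\mathbf C[L]$-module and $g_1,g_2\in\mathbf C[\lambda,\mu_1,\mu_2]$ satisfy $g_i(L,A_1,A_2)=B_i$ for $i=1,2$, then $\partial+\phi=\mathrm{gcrd}(L-\lambda,B_1-g_1,B_2-g_2)$ in $\Sigma(\Gamma)[\partial]$. 4. For each of $i=1,2$, $\partial+\phi=\mathrm{gcrd}(L-\lambda,A_i-\mu_i)$ in $\Sigma(\Gamma)[\partial]$; moreover, if $\phi_{i,0}+\phi_{i,1}\partial$, with $\phi_{i,0},\phi_{i,1}\in\Sigma[\lambda,\mu_1,\mu_2]$, is the first differential subresultant of $L-\lambda$ and $A_i-\mu_i$,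 then $\phi_{i,1}\neq0$ in $\Sigma(\Gamma)$ and $\phi_{i,0}+\phi_{i,1}\partial=\phi_{i,1}\cdot(\partial+\phi)$ in $\Sigma(\Gamma)[\partial]$, that is, $\phi=\phi_{i,0}/\phi_{i,1}$. Here the first differential subresultant of operators $P,Q$ of orders $n,m\ge1$ with $n+m\ge 3$ is $\det(S_1^0)+\det(S_1^1)\,\partial$, where $S_1$ is the matrix whose rows are the coefficients, with respect to $\partial^{n+m-2},\dots,\partial,1$, of $\partial^{m-2}P,\dots,\partial P,P,\partial^{n-2}Q,\dots,\partial Q,Q$, and $S_1^0$, $S_1^1$ are obtained from $S_1$ by removing the column of $\partial$, respectively of $1$. -/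

import Mathlib

open scoped Differential

noncomputable section

/-! ### Differential rings: constants, polynomial rings, fraction rings, differential ideals -/

/-- The field of constants of a differential field. -/
def constants (F : Type*) [Field F] [Differential F] : Subfield F where
  carrier := {a | a′ = 0}
  mul_mem' := by
    intro a b ha hb
    simp only [Set.mem_ofPred_eq] at *
    simp [ha, hb]
  one_mem' := by simp
  add_mem' := by
    intro a b ha hb
    simp only [Set.mem_ofPred_eq] at *
    simp [ha, hb]
  zero_mem' := by simp
  neg_mem' := by
    intro a ha
    simp only [Set.mem_ofPred_eq] at *
    simp [ha]
  inv_mem' := by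
    intro a ha
    simp only [Set.mem_ofPred_eq] at *
    by_cases h : a = 0
    · simp [h]
    · have h1 : (a * a⁻¹)′ = 0 := by rw [mul_inv_cancel₀ h]; simp
      rw [Derivation.leibniz, ha, smul_zero, add_zero, smul_eq_mul] at h1
      exact (mul_eq_zero.mp h1).resolve_left h

theorem mem_constants {F : Type*} [Field F] [Differential F] {a : F} :
    a ∈ constants F ↔ a′ = 0 := Iff.rfl

/-- The ring homomorphism `a ↦ f a + f a′ ε` into the dual numbers of `S`. -/
def dualHom {R S : Type*} [CommRing R] [Differential R] [CommRing S] (f : R →+* S) :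
    R →+* TrivSqZeroExt S S where
  toFun a := TrivSqZeroExt.inl (f a) + TrivSqZeroExt.inr (f a′)
  map_one' := by ext <;> simp
  map_mul' a b := by
    ext
    · simp
    · simp [mul_comm]
  map_zero' := by ext <;> simp
  map_add' a b := by ext <;> simp

theorem dualHom_fst {R S : Type*} [CommRing R] [Differential R] [CommRing S] (f : R →+* S) (a : R) :
    (dualHom f a).fst = f a := by simp [dualHom]

theorem dualHom_snd {R S : Type*} [CommRing R] [Differential R] [CommRing S] (f : R →+* S) (a : R) :
    (dualHom f a).snd = f a′ := by simp [dualHom]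

/-- The projection `a + b ε ↦ a`. -/
def dualFst (A : Type*) [CommRing A] : TrivSqZeroExt A A →+* A where
  toFun := TrivSqZeroExt.fst
  map_one' := rfl
  map_mul' _ _ := rfl
  map_zero' := rfl
  map_add' _ _ := rfl

theorem dualFst_apply {A : Type*} [CommRing A] (x : TrivSqZeroExt A A) : dualFst A x = x.fst := rfl

/-- A ring homomorphism `Φ : A → A[ε]` lifting the identity is `a ↦ a + D a ε`; this is `D`. -/
def derivationOfDual {A : Type*} [CommRing A] (Φ : A →+* TrivSqZeroExt A A)
    (h : ∀ a, (Φ a).fst = a) : Derivation ℤ A A :=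
  Derivation.mk'
    (AddMonoidHom.toIntLinearMap
      { toFun := fun a => (Φ a).snd
        map_zero' := by simp
        map_add' := fun a b => by simp })
    (fun a b => by simp [h, mul_comm])

theorem derivationOfDual_apply {A : Type*} [CommRing A] (Φ : A →+* TrivSqZeroExt A A)
    (h : ∀ a, (Φ a).fst = a) (a : A) : derivationOfDual Φ h a = (Φ a).snd := rfl

section MvPoly

variable {σ R : Type*} [CommRing R] [Differential R]

/-- The homomorphism behind the coefficientwise derivation of a polynomial ring. -/
def mvDual : MvPolynomial σ R →+* TrivSqZeroExt (MvPolynomial σ R) (MvPolynomial σ R) :=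
  MvPolynomial.eval₂Hom (dualHom (MvPolynomial.C : R →+* MvPolynomial σ R))
    (fun i => TrivSqZeroExt.inl (MvPolynomial.X i))

theorem mvDual_fst (p : MvPolynomial σ R) : (mvDual p).fst = p := by
  have h : (dualFst (MvPolynomial σ R)).comp mvDual
      = RingHom.id (MvPolynomial σ R) := by
    apply MvPolynomial.ringHom_ext
    · intro r; simp [mvDual, dualFst_apply, dualHom_fst]
    · intro i; simp [mvDual, dualFst_apply]
  exact congrArg (fun f => f p) h

/-- `R[x_i : i ∈ σ]` is a differential ring: the derivation of `R` acts on coefficients, and the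
variables are constants (`coeff_deriv_mvPolynomial`). -/
instance instDifferentialMvPolynomial : Differential (MvPolynomial σ R) :=
  ⟨derivationOfDual mvDual mvDual_fst⟩

theorem deriv_mvPolynomial_C (r : R) :
    (MvPolynomial.C r : MvPolynomial σ R)′ = MvPolynomial.C r′ := by
  change (mvDual (MvPolynomial.C r)).snd = _
  simp [mvDual, dualHom]

theorem deriv_mvPolynomial_X (i : σ) : (MvPolynomial.X i : MvPolynomial σ R)′ = 0 := by
  change (mvDual (MvPolynomial.X i)).snd = _
  simp [mvDual]

theorem coeff_deriv_mvPolynomial (p : MvPolynomial σ R) (m : σ →₀ ℕ) :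
    (p′).coeff m = (p.coeff m)′ := by
  classical
  induction p using MvPolynomial.induction_on generalizing m with
  | C a =>
    rw [deriv_mvPolynomial_C, MvPolynomial.coeff_C, MvPolynomial.coeff_C]
    split_ifs <;> simp
  | add p q hp hq => simp [hp, hq]
  | mul_X p i hp =>
    rw [Derivation.leibniz, deriv_mvPolynomial_X, smul_zero, zero_add, smul_eq_mul, mul_comm,
      MvPolynomial.coeff_mul_X', MvPolynomial.coeff_mul_X']
    split_ifs
    · exact hp _
    · simp

end MvPoly

section Frac

variable {R : Type*} [CommRing R] [Differential R]

theorem isUnit_dualHom_fractionRing (s : nonZeroDivisors R) :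
    IsUnit (dualHom (algebraMap R (FractionRing R)) s) := by
  rw [TrivSqZeroExt.isUnit_iff_isUnit_fst]
  simpa [dualHom] using IsLocalization.map_units (FractionRing R) s

/-- The homomorphism behind the derivation of a fraction ring. -/
def fracDual : FractionRing R →+* TrivSqZeroExt (FractionRing R) (FractionRing R) :=
  IsLocalization.lift (M := nonZeroDivisors R) (S := FractionRing R)
    (g := dualHom (algebraMap R (FractionRing R))) isUnit_dualHom_fractionRing

theorem fracDual_algebraMap (a : R) :
    fracDual (algebraMap R (FractionRing R) a) = dualHom (algebraMap R (FractionRing R)) a :=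
  IsLocalization.lift_eq _ a

theorem fracDual_fst (x : FractionRing R) : (fracDual x).fst = x := by
  have h : (dualFst (FractionRing R)).comp fracDual
      = RingHom.id (FractionRing R) := by
    apply IsLocalization.ringHom_ext (nonZeroDivisors R)
    ext a
    rw [RingHom.comp_apply, RingHom.comp_apply, fracDual_algebraMap, dualFst_apply, dualHom_fst]
    rfl
  exact congrArg (fun f => f x) h

/-- The (unique) extension of the derivation of `R` to its fraction ring. -/
instance instDifferentialFractionRing : Differential (FractionRing R) :=
  ⟨derivationOfDual fracDual fracDual_fst⟩

instance instDifferentialAlgebraFractionRing : DifferentialAlgebra R (FractionRing R) :=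
  ⟨fun a => by
    change (fracDual (algebraMap R (FractionRing R) a)).snd = _
    rw [fracDual_algebraMap, dualHom_snd]⟩

end Frac

section DiffIdeal

variable {R : Type*} [CommRing R] [Differential R]

/-- The differential ideal `[S]` generated by `S`: the smallest ideal that contains `S` and is
stable under the derivation. -/
def diffSpan (S : Set R) : Ideal R :=
  sInf {I : Ideal R | S ⊆ I ∧ ∀ x ∈ I, x′ ∈ I}

theorem deriv_mem_diffSpan (S : Set R) {x : R} (hx : x ∈ diffSpan S) : x′ ∈ diffSpan S := by
  simp only [diffSpan, Ideal.mem_sInf] at *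
  intro I hI
  exact hI.2 x (hx hI)

/-- The derivation of `R ⧸ [S]` induced by the derivation of `R`. -/
instance instDifferentialQuotientDiffSpan (S : Set R) : Differential (R ⧸ diffSpan S) :=
  ⟨Derivation.mk'
    (AddMonoidHom.toIntLinearMap
      (QuotientAddGroup.map (diffSpan S).toAddSubgroup (diffSpan S).toAddSubgroup
        (Differential.deriv : Derivation ℤ R R).toLinearMap.toAddMonoidHom
        (fun _ hx => deriv_mem_diffSpan S hx)))
    (fun a b => by
      obtain ⟨a, rfl⟩ := Ideal.Quotient.mk_surjective a
      obtain ⟨b, rfl⟩ := Ideal.Quotient.mk_surjective b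
      rw [← map_mul]
      change Ideal.Quotient.mk (diffSpan S) ((a * b)′)
        = Ideal.Quotient.mk (diffSpan S) a * Ideal.Quotient.mk (diffSpan S) b′
          + Ideal.Quotient.mk (diffSpan S) b * Ideal.Quotient.mk (diffSpan S) a′
      simp)⟩

theorem deriv_mk_diffSpan (S : Set R) (a : R) :
    (Ideal.Quotient.mk (diffSpan S) a)′ = Ideal.Quotient.mk (diffSpan S) a′ := rfl

end DiffIdeal

/-! ### The ring `R[∂]` of ordinary differential operators -/

section Ops

variable (R : Type*) [CommRing R] [Differential R]

/-- Ordinary differential operators `a₀ + a₁ ∂ + ⋯ + aₙ ∂ⁿ` over `R`, given by their coefficients,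
which stand to the left of the powers of `∂`. The underlying polynomial only stores the
coefficients; the product is the one with `∂ a = a ∂ + a′`. -/
def DiffOp : Type _ := Polynomial R

namespace DiffOp

instance : AddCommGroup (DiffOp R) := inferInstanceAs (AddCommGroup (Polynomial R))

/-- Left multiplication by `∂`: `∑ aᵢ ∂ⁱ ↦ ∑ (aᵢ′ ∂ⁱ + aᵢ ∂ⁱ⁺¹)`. -/
def dMul : AddMonoid.End (Polynomial R) :=
  (Differential.mapCoeffs : Derivation ℤ (Polynomial R) (Polynomial R)).toLinearMap.toAddMonoidHom
    + AddMonoidHom.mulLeft Polynomial.X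

variable {R}

theorem dMul_apply (q : Polynomial R) :
    dMul R q = Differential.mapCoeffs q + Polynomial.X * q := rfl

/-- Left multiplication by `∑ aᵢ ∂ⁱ`, that is the additive map `∑ aᵢ · (∂ ·)ⁱ`. -/
def lMul (p : Polynomial R) : AddMonoid.End (Polynomial R) :=
  Polynomial.eval₂ (Module.toAddMonoidEnd R (Polynomial R)) (dMul R) p

theorem lMul_add (p q : Polynomial R) : lMul (p + q) = lMul p + lMul q :=
  Polynomial.eval₂_add _ _

theorem lMul_zero : lMul (0 : Polynomial R) = 0 := Polynomial.eval₂_zero _ _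

theorem lMul_monomial (n : ℕ) (a : R) : lMul (Polynomial.monomial n a)
    = Module.toAddMonoidEnd R (Polynomial R) a * dMul R ^ n :=
  Polynomial.eval₂_monomial _ _

theorem lMul_smul (a : R) (q : Polynomial R) :
    lMul (a • q) = Module.toAddMonoidEnd R (Polynomial R) a * lMul q := by
  induction q using Polynomial.induction_on' with
  | add p q hp hq => rw [smul_add, lMul_add, lMul_add, hp, hq, mul_add]
  | monomial n b =>
    rw [Polynomial.smul_monomial, lMul_monomial, lMul_monomial, smul_eq_mul, map_mul, mul_assoc]

theorem dMul_mul_toEnd (a : R) : dMul R * Module.toAddMonoidEnd R (Polynomial R) a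
    = Module.toAddMonoidEnd R (Polynomial R) a′
      + Module.toAddMonoidEnd R (Polynomial R) a * dMul R := by
  ext1 q
  change dMul R (a • q) = a′ • q + a • dMul R q
  rw [dMul_apply, dMul_apply, Polynomial.smul_eq_C_mul, Derivation.leibniz,
    Differential.mapCoeffs_C]
  simp only [smul_eq_mul, Polynomial.smul_eq_C_mul]
  ring

theorem lMul_dMul (q : Polynomial R) : lMul (dMul R q) = dMul R * lMul q := by
  induction q using Polynomial.induction_on' with
  | add p q hp hq => rw [map_add, lMul_add, lMul_add, hp, hq, mul_add]
  | monomial n b =>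
    rw [dMul_apply, Differential.mapCoeffs_monomial, Polynomial.X_mul_monomial, lMul_add,
      lMul_monomial, lMul_monomial, lMul_monomial, ← mul_assoc, dMul_mul_toEnd, add_mul,
      pow_succ', mul_assoc]

theorem lMul_lMul (p q : Polynomial R) : lMul (lMul p q) = lMul p * lMul q := by
  induction p using Polynomial.induction_on' with
  | add p p' hp hp' =>
    have h : lMul (p + p') q = lMul p q + lMul p' q := by rw [lMul_add]; rfl
    rw [h, lMul_add, hp, hp', lMul_add, add_mul]
  | monomial n b =>
    have h : ∀ n : ℕ, lMul ((dMul R ^ n) q) = dMul R ^ n * lMul q := by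
      intro n
      induction n with
      | zero => simp
      | succ n ih =>
        rw [pow_succ']
        change lMul (dMul R ((dMul R ^ n) q)) = _
        rw [lMul_dMul, ih, mul_assoc]
    rw [lMul_monomial]
    change lMul (b • ((dMul R ^ n) q)) = _
    rw [lMul_smul, h, mul_assoc]

theorem lMul_one : lMul (1 : Polynomial R) = 1 := Polynomial.eval₂_one _ _

theorem lMul_apply_one (p : Polynomial R) : lMul p 1 = p := by
  induction p using Polynomial.induction_on' with
  | add p q hp hq =>
    rw [lMul_add]
    change lMul p 1 + lMul q 1 = _
    rw [hp, hq]
  | monomial n b =>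
    have h : ∀ n : ℕ, (dMul R ^ n) 1 = (Polynomial.X ^ n : Polynomial R) := by
      intro n
      induction n with
      | zero => simp
      | succ n ih =>
        rw [pow_succ']
        change dMul R ((dMul R ^ n) 1) = _
        rw [ih, dMul_apply, Derivation.leibniz_pow, Differential.mapCoeffs_X, pow_succ']
        simp
    rw [lMul_monomial]
    change b • ((dMul R ^ n) 1) = _
    rw [h, Polynomial.smul_eq_C_mul, Polynomial.C_mul_X_pow_eq_monomial]

instance : Ring (DiffOp R) where
  __ := (inferInstance : AddCommGroup (DiffOp R))
  mul p q := (lMul (R := R) p q : Polynomial R)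
  one := (1 : Polynomial R)
  mul_assoc p q r := congrArg (fun f : AddMonoid.End (Polynomial R) => f r) (lMul_lMul (R := R) p q)
  one_mul p := congrArg (fun f : AddMonoid.End (Polynomial R) => f p) (lMul_one (R := R))
  mul_one p := lMul_apply_one (R := R) p
  left_distrib p q r := map_add (lMul (R := R) p) q r
  right_distrib p q r :=
    congrArg (fun f : AddMonoid.End (Polynomial R) => f r) (lMul_add (R := R) p q)
  zero_mul p := congrArg (fun f : AddMonoid.End (Polynomial R) => f p) (lMul_zero (R := R))
  mul_zero p := map_zero (lMul (R := R) p)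

/-- The coefficient of `∂ⁱ`. -/
def coeff (P : DiffOp R) (i : ℕ) : R := Polynomial.coeff (R := R) P i

/-- The order of an operator (`0` for the zero operator). -/
def order (P : DiffOp R) : ℕ := Polynomial.natDegree (R := R) P

/-- The operator `a ∂ⁱ`. -/
def term (i : ℕ) (a : R) : DiffOp R := Polynomial.monomial i a

/-- Elements of `R` as operators of order zero. -/
def const : R →+* DiffOp R where
  toFun a := term 0 a
  map_one' := rfl
  map_mul' a b := by
    change (Polynomial.monomial 0 (a * b) : Polynomial R)
      = lMul (Polynomial.monomial 0 a) (Polynomial.monomial 0 b)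
    rw [lMul_monomial]
    change _ = a • (Polynomial.monomial 0 b : Polynomial R)
    rw [Polynomial.smul_monomial, smul_eq_mul]
  map_zero' := Polynomial.monomial_zero_right 0
  map_add' a b := map_add (Polynomial.monomial (R := R) 0) a b

variable (R) in
/-- The operator `∂`. -/
def D : DiffOp R := term 1 1

theorem D_mul_eq (P : DiffOp R) : D R * P = (dMul R P : Polynomial R) := by
  change lMul (R := R) (Polynomial.monomial 1 1) P = _
  rw [lMul_monomial, map_one, one_mul, pow_one]

/-- The commutation rule `∂ a = a ∂ + a′`. -/
theorem D_mul_const (a : R) : D R * const a = const a * D R + const a′ := by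
  rw [D_mul_eq]
  change dMul R (Polynomial.monomial 0 a)
    = lMul (Polynomial.monomial 0 a) (Polynomial.monomial 1 1) + Polynomial.monomial 0 a′
  rw [dMul_apply, lMul_monomial, Differential.mapCoeffs_monomial, Polynomial.X_mul_monomial]
  change _ = a • (Polynomial.monomial 1 1 : Polynomial R) + _
  rw [Polynomial.smul_monomial, smul_eq_mul, mul_one, add_comm]

theorem D_pow_eq (n : ℕ) : D R ^ n = term n 1 := by
  induction n with
  | zero => rfl
  | succ n ih =>
    rw [pow_succ', ih, D_mul_eq]
    change dMul R (Polynomial.monomial n 1) = Polynomial.monomial (n + 1) 1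
    rw [dMul_apply, Differential.mapCoeffs_monomial, Polynomial.X_mul_monomial]
    simp

theorem term_eq (n : ℕ) (a : R) : term n a = const a * D R ^ n := by
  rw [D_pow_eq]
  change _ = lMul (Polynomial.monomial 0 a) (Polynomial.monomial n 1)
  rw [lMul_monomial]
  change _ = a • (Polynomial.monomial n 1 : Polynomial R)
  rw [Polynomial.smul_monomial, smul_eq_mul, mul_one]
  rfl

/-- Apply a ring homomorphism to the coefficients of an operator. -/
def map {S : Type*} [CommRing S] [Differential S] (f : R →+* S) : DiffOp R →+ DiffOp S :=
  (Polynomial.mapRingHom f).toAddMonoidHom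

/-- Membership in `C[∂]`: all coefficients are constants. -/
def HasConstantCoeffs (P : DiffOp R) : Prop := ∀ i, (P.coeff i)′ = 0

/-- `G` is a right divisor (right factor) of `P`. -/
def RightDvd (G P : DiffOp R) : Prop := ∃ N : DiffOp R, P = N * G

/-- `G` is a greatest common right divisor of the operators in `S`. -/
def IsGCRD (S : Set (DiffOp R)) (G : DiffOp R) : Prop :=
  (∀ P ∈ S, RightDvd G P) ∧ ∀ H : DiffOp R, (∀ P ∈ S, RightDvd H P) → RightDvd H G

/-! First differential subresultant. Let `n` and `m` be the orders of `P` and `Q`. The matrix `S₁`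
has the `n + m - 2` rows `∂ᵐ⁻² P, …, ∂ P, P, ∂ⁿ⁻² Q, …, ∂ Q, Q` and a column for each of
`∂ⁿ⁺ᵐ⁻², …, ∂, 1`. -/

/-- The operator whose coefficients form the row number `k` of `S₁(P, Q)`. -/
def subresRow (P Q : DiffOp R) (k : ℕ) : DiffOp R :=
  if k < Q.order - 1 then D R ^ (Q.order - 2 - k) * P
  else D R ^ (P.order + Q.order - 3 - k) * Q

/-- `S₁⁰` (for `c = 0`) and `S₁¹` (for `c = 1`): the square submatrix of `S₁(P, Q)` whose columns
are those of `∂ⁿ⁺ᵐ⁻², …, ∂²`, followed by the one of `∂ᶜ`. -/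
def subresMatrix (P Q : DiffOp R) (c : ℕ) :
    Matrix (Fin (P.order + Q.order - 2)) (Fin (P.order + Q.order - 2)) R :=
  Matrix.of fun k j => (subresRow P Q k).coeff
    (if (j : ℕ) + 1 = P.order + Q.order - 2 then c else P.order + Q.order - 2 - j)

/-- The first differential subresultant `det S₁⁰ + det S₁¹ ∂` of `P` and `Q`. -/
def subres (P Q : DiffOp R) : DiffOp R :=
  const (subresMatrix P Q 0).det + const (subresMatrix P Q 1).det * D R

end DiffOp

end Ops

/-! ### Centralizers, Burchnall-Chaundy ideals and the field `Σ(Γ)` -/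

section Spectral

open DiffOp

variable {F : Type*} [Field F] [Differential F]

/-- `Σ[∂]` is an algebra over the field `C` of constants. -/
instance instAlgebraConstantsDiffOp : Algebra (constants F) (DiffOp F) :=
  RingHom.toAlgebra' (const.comp (constants F).subtype) (by
    rintro ⟨c, hc⟩ P
    rw [mem_constants] at hc
    change const c * P = P * const c
    have hD : ∀ n : ℕ, Commute (const c) (D F ^ n) := fun n =>
      Commute.pow_right (show const c * D F = D F * const c by rw [D_mul_const, hc]; simp) n
    have hterm : ∀ (n : ℕ) (a : F), Commute (const c) (term n a) := fun n a => by
      rw [term_eq]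
      exact Commute.mul_right (by
        change const c * const a = const a * const c
        rw [← map_mul, ← map_mul, mul_comm]) (hD n)
    change Commute (const c) P
    have key : ∀ p : Polynomial F, Commute (S := DiffOp F) (const c) p := by
      intro p
      induction p using Polynomial.induction_on' with
      | add p q hp hq => exact Commute.add_right (R := DiffOp F) hp hq
      | monomial n a => exact hterm n a
    exact key P)

/-- The centralizer `Z(L)` of `L` in `Σ[∂]`. -/
def centralizerOp (L : DiffOp F) : Subalgebra (constants F) (DiffOp F) :=
  Subalgebra.centralizer (constants F) {L}

/-- `C[L]`, the polynomials in `L` with constant coefficients. -/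
def polysIn (L : DiffOp F) : Subalgebra (constants F) (DiffOp F) :=
  Algebra.adjoin (constants F) {L}

/-- `L` has a nontrivial centralizer: `C[L] ⊊ Z(L) ⊊ Σ[∂]`. -/
def HasNontrivialCentralizer (L : DiffOp F) : Prop :=
  polysIn L < centralizerOp L ∧ centralizerOp L < ⊤

/-- `{1, A₁, A₂}` is a basis of `Z(L)` as a `C[L]`-module. -/
def IsCentralizerBasis (L A₁ A₂ : DiffOp F) : Prop :=
  LinearIndependent (polysIn L) ![1, A₁, A₂] ∧
    (Submodule.span (polysIn L) (Set.range ![1, A₁, A₂]) : Set (DiffOp F)) = centralizerOp L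

/-- `e_L : C[λ, μ₁, μ₂] → Σ[∂]`, `g ↦ g(L, A₁, A₂)`. The variables `λ, μ₁, μ₂` are
`X 0, X 1, X 2`. -/
def evalOps (L A₁ A₂ : DiffOp F) (g : MvPolynomial (Fin 3) (constants F)) : DiffOp F :=
  ∑ α ∈ g.support, g.coeff α • (L ^ α 0 * A₁ ^ α 1 * A₂ ^ α 2)

/-- The Burchnall-Chaundy ideal `BC(L)`, the kernel of `e_L`. (It is given by its set of elements;
it is an ideal because `L, A₁, A₂` commute.) -/
def BC (L A₁ A₂ : DiffOp F) : Set (MvPolynomial (Fin 3) (constants F)) :=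
  {g | evalOps L A₁ A₂ g = 0}

/-- The differential ideal `[BC(L)]` of `Σ[λ, μ₁, μ₂]`. -/
abbrev diffBC (L A₁ A₂ : DiffOp F) : Ideal (MvPolynomial (Fin 3) F) :=
  diffSpan (MvPolynomial.map (constants F).subtype '' BC L A₁ A₂)

/-- `Σ[Γ] = Σ[λ, μ₁, μ₂] / [BC(L)]`. -/
abbrev SpectralRing (L A₁ A₂ : DiffOp F) : Type _ := MvPolynomial (Fin 3) F ⧸ diffBC L A₁ A₂

/-- `Σ(Γ)`, the fraction field of `Σ[Γ]`, with the extended derivation. -/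
abbrev SpectralField (L A₁ A₂ : DiffOp F) : Type _ := FractionRing (SpectralRing L A₁ A₂)

/-- The canonical map `Σ[λ, μ₁, μ₂] → Σ(Γ)`. -/
def toSpectral (L A₁ A₂ : DiffOp F) : MvPolynomial (Fin 3) F →+* SpectralField L A₁ A₂ :=
  (algebraMap (SpectralRing L A₁ A₂) (SpectralField L A₁ A₂)).comp
    (Ideal.Quotient.mk (diffBC L A₁ A₂))

/-- The operator `P - g` of `Σ[λ, μ₁, μ₂][∂]`, for `P` in `Σ[∂]` and `g` in `Σ[λ, μ₁, μ₂]`. -/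
def shiftOp (P : DiffOp F) (g : MvPolynomial (Fin 3) F) : DiffOp (MvPolynomial (Fin 3) F) :=
  DiffOp.map MvPolynomial.C P - const g

/-- The operator `P - g`, for `P` in `Σ[∂]` and `g` in `Σ[λ, μ₁, μ₂]`, as an operator over
`Σ(Γ)`. -/
def shiftOpΓ (L A₁ A₂ : DiffOp F) (P : DiffOp F) (g : MvPolynomial (Fin 3) F) :
    DiffOp (SpectralField L A₁ A₂) :=
  DiffOp.map (toSpectral L A₁ A₂) (shiftOp P g)

end Spectral

end

noncomputable section

set_option linter.unusedSectionVars false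

/-! Comparing top coefficients in `L * X = X * L` gives a first-order linear equation for the
leading coefficient of `X`. Hence two elements of the centralizer of equal order have leading
coefficients in constant ratio (`exists_degree_sub_smul_lt`), and one can be reduced by a constant
multiple of the other. This makes the centralizer commutative (`commute_of_commute`), and elements
of minimal order in the residue classes mod 3 form a basis with `1`.

Let `Σ[λ, μ₁, μ₂]` act on `Σ[∂]`: `Σ` by left multiplication, `λ, μ₁, μ₂` by right multiplication by
`L, A₁, A₂` (`act`). The ideal `[BC(L)]` acts by zero, and a comparison of leading terms shows that
a polynomial killing some nonzero operator lies in `[BC(L)]` (`mem_diffBC_of_act_eq_zero`). So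
`Σ[∂]` is a torsion-free module over the quotient, which gives primality. Over `Σ[λ]` the module is
generated by `1, ∂, ∂²`, while `1, B, B²` are independent for `B` in the centralizer outside `C[L]`.
Therefore the module has rank one (`exists_act_eq_act_one`).

In particular `s₀ · ∂ = r₀ · 1` with `s₀` nonzero on the curve; put `φ = -r₀ / s₀`. Modulo the left
ideal of `∂ + φ`, every operator is congruent to the function expressing it as a multiple of `1`
(`exists_congr_const`). Since `g(L, A₁, A₂) = g · 1`, the operator `∂ + φ` divides all `g(L, A₁, A₂)
- g` on the right at once, whatever basis is used.

Conversely, let `P = L - λ` and `Q = B - b`, where `B` lies outside `C[L]` and has the value `b` on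
the curve. Their first subresultant lies in the left ideal they generate. If its coefficient of `∂`
vanished, some `Y ≠ 0` of order at most one would send `Q` into the left ideal of `P`; dividing `Q`
by `Y` would give a quadratic equation for `Q` modulo `P`, against the independence of `1, B, B²`
(`eq_zero_of_sum_pow_mem_span`). So the subresultant is a nonzero multiple of `∂ + φ`, which is thus
the gcrd already of `P` and `Q` (`subresultant_eq`). -/

namespace DiffOp

/-! ### Coefficients, degrees, and the top coefficients of products and commutators. -/

section Basic

variable {R : Type*} [CommRing R] [Differential R]

/-- The coefficients of an operator, as a polynomial. -/
def toPoly (P : DiffOp R) : Polynomial R := P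

@[ext]
theorem ext {P Q : DiffOp R} (h : ∀ i, P.coeff i = Q.coeff i) : P = Q :=
  Polynomial.ext h

theorem coeff_add (P Q : DiffOp R) (i : ℕ) : (P + Q).coeff i = P.coeff i + Q.coeff i :=
  Polynomial.coeff_add _ _ _

theorem coeff_sub (P Q : DiffOp R) (i : ℕ) : (P - Q).coeff i = P.coeff i - Q.coeff i :=
  Polynomial.coeff_sub (R := R) _ _ _

theorem coeff_zero (i : ℕ) : (0 : DiffOp R).coeff i = 0 := Polynomial.coeff_zero _

theorem coeff_sum {ι : Type*} (s : Finset ι) (f : ι → DiffOp R) (i : ℕ) :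
    (∑ j ∈ s, f j).coeff i = ∑ j ∈ s, (f j).coeff i :=
  Polynomial.finsetSum_coeff (R := R) s f i

theorem coeff_const (a : R) (i : ℕ) : (const a).coeff i = if i = 0 then a else 0 := by
  refine (Polynomial.coeff_monomial (R := R)).trans ?_
  simp [eq_comm]

theorem toPoly_const_mul (a : R) (P : DiffOp R) : toPoly (const a * P) = a • toPoly P := by
  change lMul (Polynomial.monomial 0 a) (toPoly P) = _
  rw [lMul_monomial]
  rfl

theorem coeff_const_mul (a : R) (P : DiffOp R) (i : ℕ) :
    (const a * P).coeff i = a * P.coeff i := by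
  change (toPoly (const a * P)).coeff i = _
  rw [toPoly_const_mul]
  exact Polynomial.coeff_smul a (toPoly P) i

theorem coeff_mapCoeffs (p : Polynomial R) (i : ℕ) :
    (Differential.mapCoeffs p).coeff i = (p.coeff i)′ := rfl

theorem toPoly_D_mul (P : DiffOp R) :
    toPoly (D R * P) = Differential.mapCoeffs (toPoly P) + Polynomial.X * toPoly P :=
  D_mul_eq P

theorem coeff_D_mul_zero (P : DiffOp R) : (D R * P).coeff 0 = (P.coeff 0)′ := by
  change _ = (((toPoly P).coeff 0)′)
  change (toPoly (D R * P)).coeff 0 = _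
  rw [toPoly_D_mul, Polynomial.coeff_add, coeff_mapCoeffs, Polynomial.coeff_X_mul_zero, add_zero]

theorem coeff_D_mul_succ (P : DiffOp R) (i : ℕ) :
    (D R * P).coeff (i + 1) = (P.coeff (i + 1))′ + P.coeff i := by
  change (toPoly (D R * P)).coeff (i + 1) = ((toPoly P).coeff (i + 1))′ + (toPoly P).coeff i
  rw [toPoly_D_mul, Polynomial.coeff_add, coeff_mapCoeffs, Polynomial.coeff_X_mul]

theorem coeff_D_pow (n i : ℕ) : (D R ^ n).coeff i = if i = n then 1 else 0 := by
  rw [D_pow_eq]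
  refine (Polynomial.coeff_monomial (R := R)).trans ?_
  simp [eq_comm]

/-- Induction on operators, building them by additions and left multiplications. -/
theorem induction_left {p : DiffOp R → Prop} (P : DiffOp R) (one : p 1)
    (add : ∀ P Q, p P → p Q → p (P + Q)) (const_mul : ∀ a P, p P → p (const a * P))
    (D_mul : ∀ P, p P → p (D R * P)) : p P := by
  refine Polynomial.induction_on' (motive := p) P add ?_
  intro n a
  change p (term n a)
  rw [term_eq]
  apply const_mul
  induction n with
  | zero => simpa using one
  | succ n ih => rw [pow_succ']; exact D_mul _ ih

/-- The degree of an operator, `⊥` for the zero operator. -/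
def degree (P : DiffOp R) : WithBot ℕ := Polynomial.degree (R := R) P

theorem degree_eq_bot {P : DiffOp R} : P.degree = ⊥ ↔ P = 0 := Polynomial.degree_eq_bot

theorem degree_zero : (0 : DiffOp R).degree = ⊥ := Polynomial.degree_zero

theorem degree_eq_order {P : DiffOp R} (h : P ≠ 0) : P.degree = P.order :=
  Polynomial.degree_eq_natDegree (R := R) h

theorem degree_le_order (P : DiffOp R) : P.degree ≤ P.order := Polynomial.degree_le_natDegree

theorem degree_le_iff {P : DiffOp R} {n : WithBot ℕ} :
    P.degree ≤ n ↔ ∀ i : ℕ, n < i → P.coeff i = 0 := Polynomial.degree_le_iff_coeff_zero (R := R) P n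

theorem degree_lt_iff {P : DiffOp R} {n : ℕ} :
    P.degree < n ↔ ∀ i : ℕ, n ≤ i → P.coeff i = 0 := Polynomial.degree_lt_iff_coeff_zero (R := R) P n

theorem coeff_eq_zero_of_degree_lt {P : DiffOp R} {n : ℕ} (h : P.degree < n) : P.coeff n = 0 :=
  Polynomial.coeff_eq_zero_of_degree_lt h

theorem coeff_order_ne_zero {P : DiffOp R} (h : P ≠ 0) : P.coeff P.order ≠ 0 :=
  (Polynomial.leadingCoeff_ne_zero (R := R)).mpr h

theorem order_le_of_degree_le {P : DiffOp R} {n : ℕ} (h : P.degree ≤ n) : P.order ≤ n :=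
  Polynomial.natDegree_le_of_degree_le h

theorem degree_eq_of_coeff {P : DiffOp R} {n : ℕ} (h : P.degree ≤ n) (hn : P.coeff n ≠ 0) :
    P.degree = n := Polynomial.degree_eq_of_le_of_coeff_ne_zero h hn

theorem order_eq_of_degree_eq {P : DiffOp R} {n : ℕ} (h : P.degree = n) : P.order = n :=
  Polynomial.natDegree_eq_of_degree_eq_some h

theorem degree_add_le (P Q : DiffOp R) : (P + Q).degree ≤ max P.degree Q.degree :=
  Polynomial.degree_add_le (R := R) P Q

theorem degree_sub_le (P Q : DiffOp R) : (P - Q).degree ≤ max P.degree Q.degree :=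
  Polynomial.degree_sub_le (R := R) P Q

theorem degree_sub_lt_of_coeff {P Q : DiffOp R} {n : ℕ} (hP : P.degree ≤ n) (hQ : Q.degree ≤ n)
    (h : P.coeff n = Q.coeff n) : (P - Q).degree < n := by
  rw [degree_lt_iff]
  intro i hi
  rw [coeff_sub]
  rcases hi.eq_or_lt with rfl | hi
  · rw [h, sub_self]
  · rw [coeff_eq_zero_of_degree_lt (hP.trans_lt (by exact_mod_cast hi)),
      coeff_eq_zero_of_degree_lt (hQ.trans_lt (by exact_mod_cast hi)), sub_self]

theorem degree_const_le (a : R) : (const a).degree ≤ 0 := Polynomial.degree_C_le (a := a)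

theorem degree_const {a : R} (h : a ≠ 0) : (const a).degree = 0 := Polynomial.degree_C h

theorem degree_D_pow [Nontrivial R] (n : ℕ) : (D R ^ n).degree = n := by
  rw [D_pow_eq]
  exact Polynomial.degree_monomial n one_ne_zero

theorem eq_const_of_degree_le {P : DiffOp R} (h : P.degree ≤ 0) : P = const (P.coeff 0) := by
  ext i
  rw [coeff_const]
  split_ifs with hi
  · rw [hi]
  · exact coeff_eq_zero_of_degree_lt (h.trans_lt (by exact_mod_cast Nat.pos_of_ne_zero hi))

/-- The first two terms of the Leibniz expansion of `∂ⁿ q`. The rest involves second and higher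
derivatives of `q`, so it lies at least two degrees below the top. -/
theorem exists_dMul_pow (n : ℕ) (q : Polynomial R) : ∃ r : Polynomial R,
    (dMul R ^ n) q = Polynomial.X ^ n * q
      + Polynomial.derivative (Polynomial.X ^ n) * Differential.mapCoeffs q + r ∧
    ∀ k, n + q.natDegree ≤ k + 1 → r.coeff k = 0 := by
  have hd : ∀ (p : Polynomial R) (k : ℕ), p.natDegree < k → (Differential.mapCoeffs p).coeff k = 0 :=
    fun p k h => by rw [coeff_mapCoeffs, Polynomial.coeff_eq_zero_of_natDegree_lt h]; simp
  induction n with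
  | zero => exact ⟨0, by simp, by simp⟩
  | succ n ih =>
    obtain ⟨r, hr, h⟩ := ih
    refine ⟨Polynomial.X * r + Differential.mapCoeffs r + Polynomial.derivative (Polynomial.X ^ n)
      * Differential.mapCoeffs (Differential.mapCoeffs q), ?_, ?_⟩
    · rw [pow_succ']
      change dMul R ((dMul R ^ n) q) = _
      have hX : Differential.mapCoeffs (Polynomial.derivative (Polynomial.X ^ n : Polynomial R))
          = 0 := by
        ext k
        rw [coeff_mapCoeffs, Polynomial.derivative_X_pow, Polynomial.coeff_C_mul,
          Polynomial.coeff_X_pow]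
        split_ifs <;> simp
      rw [hr, dMul_apply, map_add, map_add, Derivation.leibniz, Derivation.leibniz, hX,
        Derivation.leibniz_pow, Differential.mapCoeffs_X, pow_succ', Polynomial.derivative_mul,
        Polynomial.derivative_X]
      simp only [smul_eq_mul, mul_zero, smul_zero, add_zero]
      ring
    · intro k hk
      rw [Polynomial.coeff_add, Polynomial.coeff_add, coeff_mapCoeffs, h k (by omega)]
      have h1 : (Polynomial.X * r).coeff k = 0 := by
        cases k with
        | zero => simp
        | succ k => rw [Polynomial.coeff_X_mul]; exact h k (by omega)
      rw [h1, Polynomial.derivative_X_pow, mul_assoc, Polynomial.coeff_C_mul]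
      cases n with
      | zero => simp
      | succ n =>
        have : (Polynomial.X ^ (n + 1 - 1) * Differential.mapCoeffs (Differential.mapCoeffs q)).coeff k
            = 0 := by
          rw [Polynomial.coeff_X_pow_mul']
          split_ifs
          · rw [coeff_mapCoeffs, hd _ _ (by omega)]; simp
          · rfl
        rw [this]
        simp

/-- The two highest coefficients of a product of operators. -/
theorem coeff_mul_of_le {P Q : DiffOp R} {n m k : ℕ} (hP : P.degree ≤ n) (hQ : Q.degree ≤ m)
    (hk : n + m ≤ k + 1) : (P * Q).coeff k
      = (toPoly P * toPoly Q
        + Polynomial.derivative (toPoly P) * Differential.mapCoeffs (toPoly Q)).coeff k := by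
  have hQ' : (toPoly Q).natDegree ≤ m := order_le_of_degree_le hQ
  have hP' : (toPoly P).natDegree ≤ n := order_le_of_degree_le hP
  change (lMul (toPoly P) (toPoly Q)).coeff k = _
  generalize toPoly P = p at *
  generalize toPoly Q = q at *
  -- Both sides are additive in `p`, so monomials of degree at most `n` suffice.
  refine Polynomial.induction_with_natDegree_le
    (fun p => (lMul p q).coeff k
      = (p * q + Polynomial.derivative p * Differential.mapCoeffs q).coeff k) n ?_ ?_ ?_ p hP'
  · simp [lMul_zero]
  · intro i a _ hi
    rw [Polynomial.C_mul_X_pow_eq_monomial, lMul_monomial]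
    obtain ⟨r, hr, h⟩ := exists_dMul_pow i q
    change (a • ((dMul R ^ i) q)).coeff k = _
    rw [hr, ← Polynomial.C_mul_X_pow_eq_monomial, Polynomial.derivative_C_mul,
      mul_assoc, mul_assoc, ← mul_add, Polynomial.coeff_C_mul, Polynomial.coeff_smul,
      Polynomial.coeff_add, h k (by omega)]
    simp
  · intro f g _ _ hf hg
    rw [lMul_add]
    change ((lMul f q) + (lMul g q)).coeff k = _
    rw [Polynomial.coeff_add, hf, hg, Polynomial.derivative_add, ← Polynomial.coeff_add]
    ring_nf

theorem coeff_mul_top {P Q : DiffOp R} {n m : ℕ} (hP : P.degree ≤ n) (hQ : Q.degree ≤ m) :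
    (P * Q).coeff (n + m) = P.coeff n * Q.coeff m := by
  have hP' : (toPoly P).natDegree ≤ n := order_le_of_degree_le hP
  have hQ' : (toPoly Q).natDegree ≤ m := order_le_of_degree_le hQ
  rw [coeff_mul_of_le hP hQ (by omega), Polynomial.coeff_add,
    Polynomial.coeff_mul_add_eq_of_natDegree_le hP' hQ', Polynomial.coeff_mul,
    Finset.sum_eq_zero, add_zero]
  · rfl
  · intro x hx
    rw [Finset.HasAntidiagonal.mem_antidiagonal] at hx
    by_cases h : m < x.2
    · rw [coeff_mapCoeffs, Polynomial.coeff_eq_zero_of_natDegree_lt (hQ'.trans_lt h)]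
      simp
    · rw [Polynomial.coeff_derivative, Polynomial.coeff_eq_zero_of_natDegree_lt]
      · simp
      · omega

theorem degree_mul_le_of_le {P Q : DiffOp R} {n m : ℕ} (hP : P.degree ≤ n) (hQ : Q.degree ≤ m) :
    (P * Q).degree ≤ (n + m : ℕ) := by
  rw [degree_le_iff]
  intro i hi
  have hi : n + m < i := by exact_mod_cast hi
  -- Weakening the bound on `P` to `n + 1 + j` makes `i` the top index, and `P` has no coefficient
  -- there.
  obtain ⟨j, rfl⟩ : ∃ j, i = (n + 1 + j) + m := ⟨i - m - n - 1, by omega⟩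
  rw [coeff_mul_top (hP.trans (by norm_cast; omega)) hQ,
    coeff_eq_zero_of_degree_lt (hP.trans_lt (by norm_cast; omega)), zero_mul]

theorem degree_const_mul_le (a : R) (P : DiffOp R) : (const a * P).degree ≤ P.degree := by
  change (toPoly (const a * P)).degree ≤ _
  rw [toPoly_const_mul]
  exact Polynomial.degree_smul_le a (toPoly P)

/-- The highest coefficient of a commutator. -/
theorem coeff_commutator {P Q : DiffOp R} {n m : ℕ} (hP : P.degree ≤ (n + 1 : ℕ))
    (hQ : Q.degree ≤ m) : (P * Q - Q * P).coeff (n + m)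
      = (n + 1) * P.coeff (n + 1) * (Q.coeff m)′ - m * Q.coeff m * (P.coeff (n + 1))′ := by
  have aux : ∀ {p q : Polynomial R} {i j : ℕ}, p.natDegree ≤ i + 1 → q.natDegree ≤ j →
      (Polynomial.derivative p * Differential.mapCoeffs q).coeff (i + j)
        = p.coeff (i + 1) * (i + 1) * (q.coeff j)′ := by
    intro p q i j hp hq
    rw [Polynomial.coeff_mul_add_eq_of_natDegree_le, Polynomial.coeff_derivative, coeff_mapCoeffs]
    · exact (Polynomial.natDegree_derivative_le p).trans (by omega)
    · rw [Polynomial.natDegree_le_iff_coeff_eq_zero]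
      intro N hN
      rw [coeff_mapCoeffs, Polynomial.coeff_eq_zero_of_natDegree_lt (hq.trans_lt hN)]
      simp
  have hP' : (toPoly P).natDegree ≤ n + 1 := order_le_of_degree_le hP
  have hQ' : (toPoly Q).natDegree ≤ m := order_le_of_degree_le hQ
  rw [coeff_sub, coeff_mul_of_le hP hQ (by omega), coeff_mul_of_le hQ hP (by omega),
    Polynomial.coeff_add, Polynomial.coeff_add, aux hP' hQ',
    mul_comm (toPoly Q) (toPoly P)]
  cases m with
  | zero =>
    have : Polynomial.derivative (toPoly Q) = 0 :=
      Polynomial.derivative_of_natDegree_zero (by omega)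
    rw [this]
    simp [coeff, toPoly]
    ring
  | succ m =>
    rw [show n + (m + 1) = m + (n + 1) by ring, aux hQ' hP']
    simp [coeff, toPoly]
    ring

end Basic

/-! ### Operators over a domain: additivity of degrees, no zero divisors. -/

section Domain

variable {R : Type*} [CommRing R] [IsDomain R] [Differential R]

theorem degree_mul (P Q : DiffOp R) : (P * Q).degree = P.degree + Q.degree := by
  by_cases hP : P = 0
  · simp [hP, degree_zero]
  by_cases hQ : Q = 0
  · simp [hQ, degree_zero]
  rw [degree_eq_order hP, degree_eq_order hQ]
  have h1 := degree_le_order P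
  have h2 := degree_le_order Q
  rw [← Nat.cast_add]
  refine degree_eq_of_coeff (degree_mul_le_of_le h1 h2) ?_
  rw [coeff_mul_top h1 h2]
  exact mul_ne_zero (coeff_order_ne_zero hP) (coeff_order_ne_zero hQ)

instance : NoZeroDivisors (DiffOp R) where
  eq_zero_or_eq_zero_of_mul_eq_zero {P Q} h := by
    rw [← degree_eq_bot, degree_mul, WithBot.add_eq_bot] at h
    simpa [degree_eq_bot] using h

instance : Nontrivial (DiffOp R) := inferInstanceAs (Nontrivial (Polynomial R))

instance : IsDomain (DiffOp R) := NoZeroDivisors.to_isDomain _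

theorem order_mul {P Q : DiffOp R} (hP : P ≠ 0) (hQ : Q ≠ 0) :
    (P * Q).order = P.order + Q.order := by
  apply order_eq_of_degree_eq
  rw [degree_mul, degree_eq_order hP, degree_eq_order hQ, Nat.cast_add]

theorem order_pow {P : DiffOp R} (hP : P ≠ 0) (n : ℕ) : (P ^ n).order = n * P.order := by
  induction n with
  | zero => rw [pow_zero, zero_mul]; exact Polynomial.natDegree_one (R := R)
  | succ n ih => rw [pow_succ, order_mul (pow_ne_zero n hP) hP, ih, add_mul, one_mul]

end Domain

/-! ### Change of coefficients along a homomorphism that respects derivations. -/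

section Map

variable {R S : Type*} [CommRing R] [Differential R] [CommRing S] [Differential S]

theorem coeff_map (f : R →+* S) (P : DiffOp R) (i : ℕ) : (map f P).coeff i = f (P.coeff i) :=
  Polynomial.coeff_map f i

theorem map_const (f : R →+* S) (a : R) : map f (const a) = const (f a) :=
  Polynomial.map_monomial f

theorem map_one (f : R →+* S) : map f 1 = 1 := Polynomial.map_one f

theorem map_D (f : R →+* S) : map f (D R) = D S := by
  refine (Polynomial.map_monomial f).trans ?_
  rw [_root_.map_one]
  rfl

theorem map_const_mul (f : R →+* S) (a : R) (P : DiffOp R) :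
    map f (const a * P) = const (f a) * map f P := by
  ext i
  simp only [coeff_map, coeff_const_mul, map_mul]

theorem map_D_mul {f : R →+* S} (hf : ∀ a, f a′ = (f a)′) (P : DiffOp R) :
    map f (D R * P) = D S * map f P := by
  ext i
  cases i with
  | zero => rw [coeff_map, coeff_D_mul_zero, coeff_D_mul_zero, coeff_map, hf]
  | succ i => simp only [coeff_map, coeff_D_mul_succ, map_add, hf]

theorem map_mul {f : R →+* S} (hf : ∀ a, f a′ = (f a)′) (P Q : DiffOp R) :
    map f (P * Q) = map f P * map f Q := by
  induction P using induction_left with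
  | one => rw [one_mul, map_one, one_mul]
  | add P P' h h' => rw [add_mul, map_add, h, h', map_add, add_mul]
  | const_mul a P h => rw [mul_assoc, map_const_mul, h, map_const_mul, mul_assoc]
  | D_mul P h => rw [mul_assoc, map_D_mul hf, h, map_D_mul hf, mul_assoc]

theorem map_pow {f : R →+* S} (hf : ∀ a, f a′ = (f a)′) (P : DiffOp R) (n : ℕ) :
    map f (P ^ n) = map f P ^ n := by
  induction n with
  | zero => exact map_one f
  | succ n ih => rw [pow_succ, map_mul hf, ih, pow_succ]

theorem map_map {T : Type*} [CommRing T] [Differential T] (g : S →+* T) (f : R →+* S)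
    (P : DiffOp R) : map g (map f P) = map (g.comp f) P := Polynomial.map_map f g P

end Map

/-! ### Right division over a differential field. -/

section Division

variable {K : Type*} [Field K] [Differential K]

/-- Division with remainder on the right. -/
theorem exists_eq_mul_add {G : DiffOp K} (hG : G ≠ 0) (P : DiffOp K) :
    ∃ N R : DiffOp K, P = N * G + R ∧ R.degree < G.order := by
  have key : ∀ (n : ℕ) (P : DiffOp K), P.degree < n →
      ∃ N R : DiffOp K, P = N * G + R ∧ R.degree < G.order := by
    intro n
    induction n with
    | zero =>
      intro P hP
      exact ⟨0, P, by simp, hP.trans_le (by simp)⟩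
    | succ n ih =>
      intro P hP
      by_cases hn : n < G.order
      · exact ⟨0, P, by simp, hP.trans_le (by norm_cast)⟩
      have hP' : P.degree ≤ n := by
        rw [degree_le_iff]
        exact fun i hi => degree_lt_iff.mp hP i (by exact_mod_cast hi)
      set A := const (P.coeff n / G.coeff G.order) * D K ^ (n - G.order)
      have hA : A.degree ≤ (n - G.order : ℕ) :=
        (degree_const_mul_le _ _).trans (degree_D_pow _).le
      have hsum : n - G.order + G.order = n := by omega
      have hAG : (A * G).degree ≤ n := by
        have := degree_mul_le_of_le hA (degree_le_order G)
        rwa [hsum] at this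
      obtain ⟨N, R, h, hR⟩ := ih (P - A * G) (by
        refine degree_sub_lt_of_coeff hP' hAG ?_
        have := coeff_mul_top hA (degree_le_order G)
        rw [hsum] at this
        rw [this, coeff_const_mul, coeff_D_pow, if_pos rfl, mul_one,
          div_mul_cancel₀ _ (coeff_order_ne_zero hG)])
      exact ⟨N + A, R, by rw [add_mul, add_right_comm, ← h, sub_add_cancel], hR⟩
  exact key (P.order + 1) P ((degree_le_order P).trans_lt (by norm_cast; omega))

end Division

/-! ### Sums of operators of pairwise distinct orders. -/

section Sums

variable {R : Type*} [CommRing R] [Differential R] {ι : Type*} {s : Finset ι} {f : ι → DiffOp R}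

/-- Terms of distinct orders cannot cancel. Every linear independence proved below comes down to
this. -/
theorem degree_sum_of_order_injOn
    (h : ∀ i ∈ s, ∀ j ∈ s, f i ≠ 0 → f j ≠ 0 → (f i).order = (f j).order → i = j) :
    (∑ i ∈ s, f i).degree = s.sup fun i => (f i).degree := by
  refine Polynomial.degree_sum_eq_of_disjoint (R := R) f s ?_
  intro i hi j hj hij heq
  refine hij (h i hi.1 j hj.1 hi.2 hj.2 ?_)
  exact Polynomial.natDegree_eq_of_degree_eq (R := R) heq

theorem sum_ne_zero_of_order_injOn
    (h : ∀ i ∈ s, ∀ j ∈ s, f i ≠ 0 → f j ≠ 0 → (f i).order = (f j).order → i = j)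
    {i : ι} (hi : i ∈ s) (hfi : f i ≠ 0) : ∑ i ∈ s, f i ≠ 0 := by
  intro h0
  have h1 := degree_sum_of_order_injOn h
  rw [h0, degree_zero] at h1
  have h2 : (f i).degree ≤ ⊥ := h1 ▸ Finset.le_sup (f := fun i => (f i).degree) hi
  exact hfi (degree_eq_bot.mp (le_bot_iff.mp h2))

theorem exists_order_sum_eq
    (h : ∀ i ∈ s, ∀ j ∈ s, f i ≠ 0 → f j ≠ 0 → (f i).order = (f j).order → i = j)
    (h0 : ∑ i ∈ s, f i ≠ 0) : ∃ i ∈ s, f i ≠ 0 ∧ (∑ i ∈ s, f i).order = (f i).order := by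
  have hs : s.Nonempty := by
    rw [Finset.nonempty_iff_ne_empty]
    rintro rfl
    exact h0 rfl
  obtain ⟨i, hi, h1⟩ := Finset.exists_mem_eq_sup s hs fun i => (f i).degree
  rw [← degree_sum_of_order_injOn h] at h1
  refine ⟨i, hi, ?_, Polynomial.natDegree_eq_of_degree_eq (R := R) h1⟩
  intro hfi
  rw [hfi, degree_zero, degree_eq_bot] at h1
  exact h0 h1

end Sums

/-! ### The centralizer of an operator of order three: commutativity and a basis. -/

section Centralizer

variable {F : Type*} [Field F] [Differential F]

theorem constants_smul_eq (c : constants F) (P : DiffOp F) : c • P = const (c : F) * P :=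
  Algebra.smul_def c P

theorem mem_centralizerOp {L A : DiffOp F} : A ∈ centralizerOp L ↔ L * A = A * L := by
  simp [centralizerOp, Subalgebra.mem_centralizer_iff]

theorem mem_polysIn {L A : DiffOp F} :
    A ∈ polysIn L ↔ ∃ p : Polynomial (constants F), Polynomial.aeval L p = A := by
  rw [polysIn, Algebra.adjoin_singleton_eq_range_aeval]
  rfl

theorem self_mem_centralizerOp (L : DiffOp F) : L ∈ centralizerOp L := mem_centralizerOp.mpr rfl

theorem order_zero : (0 : DiffOp F).order = 0 := Polynomial.natDegree_zero (R := F)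

theorem ne_zero_of_order_eq {L : DiffOp F} {n : ℕ} (h : L.order = n + 1) : L ≠ 0 := by
  rintro rfl
  rw [order_zero] at h
  omega

theorem polysIn_le_centralizerOp (L : DiffOp F) : polysIn L ≤ centralizerOp L :=
  Algebra.adjoin_le (by simpa using self_mem_centralizerOp L)

theorem three_dvd_order_of_mem_polysIn {L : DiffOp F} (hL : L.order = 3) {A : DiffOp F}
    (hA : A ∈ polysIn L) (h0 : A ≠ 0) : 3 ∣ A.order := by
  have hL0 := ne_zero_of_order_eq hL
  obtain ⟨p, rfl⟩ := mem_polysIn.mp hA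
  have hord : ∀ i : ℕ, p.coeff i • L ^ i ≠ 0 → (p.coeff i • L ^ i).order = i * 3 := by
    intro i hi
    rw [constants_smul_eq] at hi ⊢
    rw [order_mul (left_ne_zero_of_mul hi) (right_ne_zero_of_mul hi), order_pow hL0, hL,
      show (const (p.coeff i : F)).order = 0 from Polynomial.natDegree_C (p.coeff i : F), zero_add]
  rw [Polynomial.aeval_eq_sum_range] at h0 ⊢
  obtain ⟨i, -, hi, h⟩ := exists_order_sum_eq (by
    intro i _ j _ hi hj hij
    rw [hord i hi, hord j hj] at hij
    omega) h0
  rw [h, hord i hi]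
  exact dvd_mul_left 3 i

variable [CharZero F]

/-- Operators of the same order in the centralizer have proportional leading coefficients. -/
theorem exists_degree_sub_smul_lt {L : DiffOp F} (hL : L.order = 3) {A B : DiffOp F}
    (hA : A ∈ centralizerOp L) (hB : B ∈ centralizerOp L) (hA0 : A ≠ 0)
    (hBA : B.degree ≤ A.order) : ∃ c : constants F, (B - c • A).degree < A.order := by
  set m := A.order
  have hl : L.coeff 3 ≠ 0 := hL ▸ coeff_order_ne_zero (ne_zero_of_order_eq hL)
  have hLd : L.degree ≤ (2 + 1 : ℕ) := by
    simpa [hL] using degree_le_order L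
  -- The top coefficient, of index `m + 2`, of the vanishing commutator of `L` and `X`.
  have key : ∀ {X : DiffOp F}, X ∈ centralizerOp L → X.degree ≤ m →
      3 * L.coeff 3 * (X.coeff m)′ = m * X.coeff m * (L.coeff 3)′ := by
    intro X hX hXd
    have h := coeff_commutator hLd hXd
    rw [mem_centralizerOp.mp hX, sub_self, coeff_zero] at h
    have h' := sub_eq_zero.mp h.symm
    norm_num at h'
    exact h'
  have ha : A.coeff m ≠ 0 := coeff_order_ne_zero hA0
  set c := B.coeff m / A.coeff m with hcdef
  have hc : B.coeff m = c * A.coeff m := by rw [hcdef, div_mul_cancel₀ _ ha]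
  have h1 := key hA (degree_le_order A)
  have h2 := key hB hBA
  rw [hc, Derivation.leibniz, smul_eq_mul, smul_eq_mul] at h2
  -- The leading coefficients satisfy the same linear equation, so their ratio `c` has derivative
  -- zero.
  have h3 : 3 * L.coeff 3 * A.coeff m * c′ = 0 := by linear_combination h2 - c * h1
  have h4 : c′ = 0 := (mul_eq_zero.mp h3).resolve_left
    (mul_ne_zero (mul_ne_zero three_ne_zero hl) ha)
  refine ⟨⟨c, h4⟩, ?_⟩
  rw [constants_smul_eq]
  exact degree_sub_lt_of_coeff hBA ((degree_const_mul_le _ _).trans (degree_le_order A))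
    (by rw [coeff_const_mul, hc])

theorem order_lt_of_degree_lt {P : DiffOp F} {n : ℕ} (hP : P ≠ 0) (h : P.degree < n) :
    P.order < n := by
  rw [degree_eq_order hP] at h
  exact_mod_cast h

/-- Outside `C[L]`, the order can be made prime to `3` by subtracting an element of `C[L]`. -/
theorem exists_not_dvd_order_sub {L : DiffOp F} (hL : L.order = 3) {B : DiffOp F}
    (hB : B ∈ centralizerOp L) (hB' : B ∉ polysIn L) :
    ∃ p : Polynomial (constants F), ¬ 3 ∣ (B - Polynomial.aeval L p).order := by
  induction hn : B.order using Nat.strong_induction_on generalizing B with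
  | _ n ih =>
    by_cases h3 : 3 ∣ n
    · obtain ⟨j, rfl⟩ := h3
      have hL0 := ne_zero_of_order_eq hL
      have hord : (L ^ j).order = 3 * j := by rw [order_pow hL0, hL, mul_comm]
      obtain ⟨c, hc⟩ := exists_degree_sub_smul_lt hL
        (Subalgebra.pow_mem _ (self_mem_centralizerOp L) j) hB (pow_ne_zero j hL0)
        (by rw [hord, ← hn]; exact degree_le_order B)
      have hmem : c • L ^ j ∈ polysIn L :=
        Subalgebra.smul_mem _ (Subalgebra.pow_mem _ (Algebra.self_mem_adjoin_singleton _ L) j) c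
      -- Staying outside `C[L]` keeps the remainder nonzero, so the descent can only stop at an
      -- order prime to 3.
      have hB1 : B - c • L ^ j ∉ polysIn L := fun h =>
        hB' (by simpa using Subalgebra.add_mem _ h hmem)
      have hne : B - c • L ^ j ≠ 0 := fun h => hB1 (h ▸ Subalgebra.zero_mem _)
      obtain ⟨p, hp⟩ := ih _ (by rw [← hord]; exact order_lt_of_degree_lt hne hc)
        (Subalgebra.sub_mem _ hB (polysIn_le_centralizerOp L hmem)) hB1 rfl
      refine ⟨p + Polynomial.C c * Polynomial.X ^ j, ?_⟩
      have : B - Polynomial.aeval L (p + Polynomial.C c * Polynomial.X ^ j)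
          = B - c • L ^ j - Polynomial.aeval L p := by
        rw [map_add, _root_.map_mul, Polynomial.aeval_C, _root_.map_pow, Polynomial.aeval_X, ← Algebra.smul_def]
        abel
      rwa [this]
    · exact ⟨0, by simpa [hn] using h3⟩

theorem exists_mem_centralizerOp_not_dvd {L : DiffOp F} (hL : L.order = 3)
    (hZ : polysIn L < centralizerOp L) : ∃ B ∈ centralizerOp L, ¬ 3 ∣ B.order := by
  obtain ⟨B, hB, hB'⟩ := SetLike.exists_of_lt hZ
  obtain ⟨p, hp⟩ := exists_not_dvd_order_sub hL hB hB'
  exact ⟨_, Subalgebra.sub_mem _ hB (polysIn_le_centralizerOp L (mem_polysIn.mpr ⟨p, rfl⟩)), hp⟩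

/-- A number prime to 3 is invertible mod 3, so the orders of `1, B, B²` meet every residue class.
-/
theorem exists_mul_mod_three_eq {m : ℕ} (hm : ¬ 3 ∣ m) (n : ℕ) : ∃ k < 3, k * m % 3 = n % 3 := by
  rcases (show m % 3 = 1 ∨ m % 3 = 2 by omega) with h | h <;>
  rcases (show n % 3 = 0 ∨ n % 3 = 1 ∨ n % 3 = 2 by omega) with h' | h' | h'
  exacts [⟨0, by omega⟩, ⟨1, by omega⟩, ⟨2, by omega⟩, ⟨0, by omega⟩, ⟨2, by omega⟩, ⟨1, by omega⟩]

/-- Descent on the defect `ord X + ord Y - ord [X, Y]`, which is nonnegative when the commutator is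
nonzero. A suitable `L ^ i * B ^ k` has the order of `L ^ j * X` and commutes with `Y`. Subtracting
a multiple of it lowers the order of `L ^ j * X` but leaves the commutator `L ^ j * [X, Y]`
unchanged, so the defect drops. -/
theorem commute_of_commute {L : DiffOp F} (hL : L.order = 3) {B Y : DiffOp F}
    (hB : B ∈ centralizerOp L) (hB3 : ¬ 3 ∣ B.order) (hY : Y ∈ centralizerOp L)
    (hBY : Commute B Y) {X : DiffOp F} (hX : X ∈ centralizerOp L) : Commute X Y := by
  have hL0 := ne_zero_of_order_eq hL
  have hB0 : B ≠ 0 := by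
    rintro rfl
    exact hB3 (by rw [order_zero]; exact dvd_zero 3)
  have hLY : Commute L Y := mem_centralizerOp.mp hY
  induction hn : X.order + Y.order - (X * Y - Y * X).order using Nat.strong_induction_on
    generalizing X with
  | _ n ih =>
    by_contra hXY
    have hC0 : X * Y - Y * X ≠ 0 := fun h => hXY (sub_eq_zero.mp h)
    set C := X * Y - Y * X with hC
    have hX0 : X ≠ 0 := by rintro rfl; exact hXY (Commute.zero_left Y)
    -- With `j = k * ord B`, the equality `3 i + k * ord B = 3 j + ord X` reads `3 i = ord X + 2 k *
    -- ord B`; it is solvable once `k * ord B` and `ord X` agree mod 3.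
    obtain ⟨k, i, hki⟩ : ∃ k i, X.order + 2 * (k * B.order) = 3 * i := by
      obtain ⟨k, -, hk⟩ := exists_mul_mod_three_eq hB3 X.order
      exact ⟨k, (X.order + 2 * (k * B.order)) / 3, by omega⟩
    set j := k * B.order with hj
    have hE : (L ^ i * B ^ k).order = 3 * j + X.order := by
      rw [order_mul (pow_ne_zero _ hL0) (pow_ne_zero _ hB0), order_pow hL0, order_pow hB0, hL]
      omega
    have hLX : (L ^ j * X).order = 3 * j + X.order := by
      rw [order_mul (pow_ne_zero _ hL0) hX0, order_pow hL0, hL]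
      omega
    have hEm : L ^ i * B ^ k ∈ centralizerOp L :=
      Subalgebra.mul_mem _ (Subalgebra.pow_mem _ (self_mem_centralizerOp L) i)
        (Subalgebra.pow_mem _ hB k)
    have hLXm : L ^ j * X ∈ centralizerOp L :=
      Subalgebra.mul_mem _ (Subalgebra.pow_mem _ (self_mem_centralizerOp L) j) hX
    obtain ⟨c, hc⟩ := exists_degree_sub_smul_lt hL hEm hLXm
      (mul_ne_zero (pow_ne_zero _ hL0) (pow_ne_zero _ hB0))
      (by rw [hE, ← hLX]; exact degree_le_order _)
    set X₁ := L ^ j * X - c • (L ^ i * B ^ k) with hX₁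
    have hcom : Commute (c • (L ^ i * B ^ k)) Y :=
      ((hLY.pow_left i).mul_left (hBY.pow_left k)).smul_left c
    have hLjY : L ^ j * Y = Y * L ^ j := hLY.pow_left j
    have hC₁ : X₁ * Y - Y * X₁ = L ^ j * C := by
      have h1 : X₁ * Y - Y * X₁ = L ^ j * X * Y - Y * (L ^ j * X) := by
        rw [hX₁, sub_mul, mul_sub, hcom.eq]
        abel
      rw [h1, hC, mul_sub, ← mul_assoc Y, ← hLjY, mul_assoc, mul_assoc]
    have hne : X₁ ≠ 0 := by
      intro h
      rw [h, zero_mul, mul_zero, sub_zero] at hC₁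
      exact mul_ne_zero (pow_ne_zero j hL0) hC0 hC₁.symm
    have hlt := order_lt_of_degree_lt hne hc
    have hCo : (L ^ j * C).order = 3 * j + C.order := by
      rw [order_mul (pow_ne_zero j hL0) hC0, order_pow hL0, hL, mul_comm]
    -- This bound ensures that the truncated subtraction in the defect really decreases.
    have hle : (X₁ * Y - Y * X₁).order ≤ X₁.order + Y.order := by
      apply order_le_of_degree_le
      refine (degree_sub_le _ _).trans (max_le ?_ ?_)
      · exact degree_mul_le_of_le (degree_le_order _) (degree_le_order _)
      · rw [add_comm]
        exact degree_mul_le_of_le (degree_le_order _) (degree_le_order _)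
    rw [hC₁, hCo] at hle
    have hcomm := ih (X₁.order + Y.order - (X₁ * Y - Y * X₁).order) (by
      rw [hC₁, hCo, ← hn]
      omega) (Subalgebra.sub_mem _ hLXm (Subalgebra.smul_mem _ hEm c)) rfl
    rw [hcomm.eq, sub_self] at hC₁
    exact mul_ne_zero (pow_ne_zero j hL0) hC0 hC₁.symm

/-- A nontrivial centralizer is commutative. -/
theorem commute_of_mem_centralizerOp {L : DiffOp F} (hL : L.order = 3)
    (hZ : polysIn L < centralizerOp L) {X Y : DiffOp F} (hX : X ∈ centralizerOp L)
    (hY : Y ∈ centralizerOp L) : Commute X Y := by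
  obtain ⟨B, hB, hB3⟩ := exists_mem_centralizerOp_not_dvd hL hZ
  -- The inner use, with `B` as the second operator, shows that `B` commutes with everything; the
  -- outer one passes from `B` to `X`.
  exact commute_of_commute hL hB hB3 hY
    (commute_of_commute hL hB hB3 hB (Commute.refl B) hY).symm hX

/-- Minimality is what makes every order in the class the order of some `L ^ j * A`. -/
theorem exists_minimal_order {L : DiffOp F} (r : ℕ)
    (h : ∃ A ∈ centralizerOp L, A.order % 3 = r) : ∃ A ∈ centralizerOp L, A.order % 3 = r ∧
      ∀ B ∈ centralizerOp L, B.order % 3 = r → A.order ≤ B.order := by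
  classical
  have h' : ∃ n, ∃ A ∈ centralizerOp L, A.order % 3 = r ∧ A.order = n := by
    obtain ⟨A, hA, hr⟩ := h
    exact ⟨_, A, hA, hr, rfl⟩
  obtain ⟨A, hA, hr, hn⟩ := Nat.find_spec h'
  exact ⟨A, hA, hr, fun B hB hBr => hn ▸ Nat.find_min' h' ⟨B, hB, hBr, rfl⟩⟩

/-- A nontrivial centralizer has a basis `{1, A₁, A₂}`. -/
theorem exists_isCentralizerBasis {L : DiffOp F} (hL : L.order = 3)
    (hZ : polysIn L < centralizerOp L) : ∃ A₁ A₂ : DiffOp F, IsCentralizerBasis L A₁ A₂ := by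
  have hL0 := ne_zero_of_order_eq hL
  have hex : ∀ r < 3, ∃ A ∈ centralizerOp L, A.order % 3 = r := by
    intro r hr
    obtain ⟨B, hB, hB3⟩ := exists_mem_centralizerOp_not_dvd hL hZ
    have hB0 : B ≠ 0 := by
      rintro rfl
      exact hB3 (by rw [order_zero]; exact dvd_zero 3)
    obtain ⟨k, -, hk⟩ := exists_mul_mod_three_eq hB3 r
    exact ⟨B ^ k, Subalgebra.pow_mem _ hB k, by rw [order_pow hB0, hk, Nat.mod_eq_of_lt hr]⟩
  obtain ⟨A₁, hA₁, h₁, hmin₁⟩ := exists_minimal_order 1 (hex 1 (by norm_num))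
  obtain ⟨A₂, hA₂, h₂, hmin₂⟩ := exists_minimal_order 2 (hex 2 (by norm_num))
  set A : Fin 3 → DiffOp F := ![1, A₁, A₂] with hAdef
  have hone : (1 : DiffOp F).order = 0 := Polynomial.natDegree_one (R := F)
  have hA : ∀ k, A k ∈ centralizerOp L := by
    intro k
    fin_cases k
    exacts [Subalgebra.one_mem _, hA₁, hA₂]
  have hr : ∀ k, (A k).order % 3 = k := by
    intro k
    fin_cases k
    exacts [by simp [hAdef, hone], h₁, h₂]
  have hA0 : ∀ k, A k ≠ 0 := by
    intro k h
    have hk := hr k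
    rw [h, order_zero] at hk
    have : k = 0 := Fin.ext hk.symm
    subst this
    exact one_ne_zero h
  have hmin : ∀ k : Fin 3, ∀ B ∈ centralizerOp L, B.order % 3 = k → (A k).order ≤ B.order := by
    intro k
    fin_cases k
    · intro B _ _
      exact hone.le.trans (Nat.zero_le _)
    · exact hmin₁
    · exact hmin₂
  refine ⟨A₁, A₂, ?_, ?_⟩
  · rw [Fintype.linearIndependent_iff]
    intro g hg k
    by_contra hk
    have hk' : (g k : DiffOp F) ≠ 0 := by simpa using hk
    -- Nonzero elements of `C[L]` have order divisible by 3, so the order of `g i * A i` is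
    -- congruent to `i` mod 3 and the terms cannot cancel.
    refine sum_ne_zero_of_order_injOn (s := Finset.univ) (f := fun i => g i • A i) ?_
      (Finset.mem_univ k) (mul_ne_zero hk' (hA0 k)) hg
    intro i _ j _ hi hj hij
    change ((g i : DiffOp F) * A i).order = ((g j : DiffOp F) * A j).order at hij
    have hi' : (g i : DiffOp F) ≠ 0 := left_ne_zero_of_mul (b := A i) hi
    have hj' : (g j : DiffOp F) ≠ 0 := left_ne_zero_of_mul (b := A j) hj
    rw [order_mul hi' (hA0 i), order_mul hj' (hA0 j)] at hij
    have hi3 := three_dvd_order_of_mem_polysIn hL (g i).2 hi'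
    have hj3 := three_dvd_order_of_mem_polysIn hL (g j).2 hj'
    have hri := hr i
    have hrj := hr j
    ext
    omega
  · apply Set.Subset.antisymm
    · intro B hB
      induction hB using Submodule.span_induction with
      | mem x hx =>
        obtain ⟨k, rfl⟩ := hx
        exact hA k
      | zero => exact Subalgebra.zero_mem _
      | add x y _ _ hx hy => exact Subalgebra.add_mem _ hx hy
      | smul a x _ hx => exact Subalgebra.mul_mem _ (polysIn_le_centralizerOp L a.2) hx
    · intro B hB
      change B ∈ Submodule.span (polysIn L) (Set.range A)
      change B ∈ centralizerOp L at hB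
      induction hn : B.order using Nat.strong_induction_on generalizing B with
      | _ n ih =>
        by_cases hB0 : B = 0
        · rw [hB0]
          exact Submodule.zero_mem _
        -- The residue of the order selects the basis element; subtracting a constant multiple of `L
        -- ^ j * A k` lowers the order.
        set k : Fin 3 := ⟨n % 3, Nat.mod_lt _ (by norm_num)⟩ with hk
        have hle := hmin k B hB (by rw [hn])
        have hrk : (A k).order % 3 = n % 3 := hr k
        obtain ⟨j, hj⟩ : ∃ j, n = 3 * j + (A k).order := ⟨(n - (A k).order) / 3, by omega⟩
        have hE : (L ^ j * A k).order = n := by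
          rw [order_mul (pow_ne_zero _ hL0) (hA0 k), order_pow hL0, hL, hj, mul_comm]
        have hEm : L ^ j * A k ∈ centralizerOp L :=
          Subalgebra.mul_mem _ (Subalgebra.pow_mem _ (self_mem_centralizerOp L) j) (hA k)
        obtain ⟨c, hc⟩ := exists_degree_sub_smul_lt hL hEm hB
          (mul_ne_zero (pow_ne_zero _ hL0) (hA0 k)) (by rw [hE, ← hn]; exact degree_le_order B)
        have hspan : c • (L ^ j * A k) ∈ Submodule.span (polysIn L) (Set.range A) := by
          have : c • (L ^ j * A k) = (⟨c • L ^ j, Subalgebra.smul_mem _ (Subalgebra.pow_mem _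
              (Algebra.self_mem_adjoin_singleton _ L) j) c⟩ : polysIn L) • A k := by
            change _ = (c • L ^ j) * A k
            rw [smul_mul_assoc]
          rw [this]
          exact Submodule.smul_mem _ _ (Submodule.subset_span ⟨k, rfl⟩)
        rw [← sub_add_cancel B (c • (L ^ j * A k))]
        refine Submodule.add_mem _ ?_ hspan
        by_cases hne : B - c • (L ^ j * A k) = 0
        · rw [hne]
          exact Submodule.zero_mem _
        · exact ih _ (hE ▸ order_lt_of_degree_lt hne hc)
            (Subalgebra.sub_mem _ hB (Subalgebra.smul_mem _ hEm c)) rfl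

end Centralizer

/-! ### The action of `Σ[λ, μ₁, μ₂]` on `Σ[∂]`, and primality of `[BC(L)]`. -/

section Action

variable {F : Type*} [Field F] [Differential F]

/-- `L`, `A₁`, `A₂` commute with each other. -/
structure IsCommutingTriple (L A₁ A₂ : DiffOp F) : Prop where
  left : A₁ ∈ centralizerOp L
  right : A₂ ∈ centralizerOp L
  comm : Commute A₁ A₂

variable {L A₁ A₂ : DiffOp F}

/-- The monomial `L ^ α₀ * A₁ ^ α₁ * A₂ ^ α₂`. -/
def opMonomial (h : IsCommutingTriple L A₁ A₂) : Multiplicative (Fin 3 →₀ ℕ) →* DiffOp F where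
  toFun α := L ^ α.toAdd 0 * A₁ ^ α.toAdd 1 * A₂ ^ α.toAdd 2
  map_one' := by simp
  map_mul' α β := by
    have h1 : Commute L A₁ := mem_centralizerOp.mp h.left
    have h2 : Commute L A₂ := mem_centralizerOp.mp h.right
    have e1 := (h1.pow_pow (β.toAdd 0) (α.toAdd 1)).eq
    have e2 := (h2.pow_pow (β.toAdd 0) (α.toAdd 2)).eq
    have e3 := (h.comm.pow_pow (β.toAdd 1) (α.toAdd 2)).eq
    simp only [toAdd_mul, Finsupp.add_apply, pow_add]
    calc _ = L ^ α.toAdd 0 * (L ^ β.toAdd 0 * A₁ ^ α.toAdd 1)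
          * (A₁ ^ β.toAdd 1 * A₂ ^ α.toAdd 2) * A₂ ^ β.toAdd 2 := by simp only [mul_assoc]
      _ = L ^ α.toAdd 0 * A₁ ^ α.toAdd 1 * (L ^ β.toAdd 0 * A₂ ^ α.toAdd 2)
          * A₁ ^ β.toAdd 1 * A₂ ^ β.toAdd 2 := by rw [e1, e3]; simp only [mul_assoc]
      _ = _ := by rw [e2]; simp only [mul_assoc]

/-- The action of `Σ[λ, μ₁, μ₂]` on `Σ[∂]`: elements of `Σ` act by multiplication on the left, and
`λ, μ₁, μ₂` act by multiplication by `L, A₁, A₂` on the right. -/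
def act (h : IsCommutingTriple L A₁ A₂) :
    MvPolynomial (Fin 3) F →+* AddMonoid.End (DiffOp F) :=
  AddMonoidAlgebra.liftNCRingHom ((Module.toAddMonoidEnd (DiffOp F) (DiffOp F)).comp const)
    { toFun := fun α => AddMonoidHom.mulRight (opMonomial h α)
      map_one' := by
        ext1 X
        change X * opMonomial h 1 = X
        rw [_root_.map_one, mul_one]
      map_mul' := fun α β => by
        ext1 X
        change X * opMonomial h (α * β) = X * opMonomial h β * opMonomial h α
        -- Right multiplications compose in reverse order, which is harmless because exponents add
        -- commutatively.
        rw [mul_comm α, _root_.map_mul, mul_assoc] }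
    (fun a α => by
      ext1 X
      change const a * (X * opMonomial h α) = const a * X * opMonomial h α
      rw [mul_assoc])

variable (h : IsCommutingTriple L A₁ A₂)

theorem act_monomial (α : Fin 3 →₀ ℕ) (a : F) (X : DiffOp F) :
    act h (MvPolynomial.monomial α a) X
      = const a * (X * (L ^ α 0 * A₁ ^ α 1 * A₂ ^ α 2)) := by
  have : act h (MvPolynomial.monomial α a) = _ := AddMonoidAlgebra.liftNCRingHom_single _ _ _ α a
  rw [this]
  rfl

theorem act_C (a : F) (X : DiffOp F) : act h (MvPolynomial.C a) X = const a * X := by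
  rw [MvPolynomial.C_apply, act_monomial]
  simp

theorem act_X (i : Fin 3) (X : DiffOp F) :
    act h (MvPolynomial.X i) X = X * ![L, A₁, A₂] i := by
  rw [MvPolynomial.X, act_monomial]
  fin_cases i <;> simp

theorem act_mul (g g' : MvPolynomial (Fin 3) F) (X : DiffOp F) :
    act h (g * g') X = act h g (act h g' X) := by
  rw [_root_.map_mul]
  rfl

theorem act_add (g g' : MvPolynomial (Fin 3) F) (X : DiffOp F) :
    act h (g + g') X = act h g X + act h g' X := by
  rw [map_add]
  rfl

theorem act_sub (g g' : MvPolynomial (Fin 3) F) (X : DiffOp F) :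
    act h (g - g') X = act h g X - act h g' X := by
  rw [map_sub]
  rfl

theorem act_zero (X : DiffOp F) : act h 0 X = 0 := by
  rw [map_zero]
  rfl

theorem act_one (X : DiffOp F) : act h 1 X = X := by
  rw [_root_.map_one]
  rfl

theorem act_sum {ι : Type*} (s : Finset ι) (f : ι → MvPolynomial (Fin 3) F) (X : DiffOp F) :
    act h (∑ i ∈ s, f i) X = ∑ i ∈ s, act h (f i) X := by
  classical
  induction s using Finset.induction_on with
  | empty => exact act_zero h X
  | insert i s hi ih => rw [Finset.sum_insert hi, Finset.sum_insert hi, act_add, ih]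

/-- The action satisfies the Leibniz rule. -/
theorem D_mul_act (g : MvPolynomial (Fin 3) F) (X : DiffOp F) :
    D F * act h g X = act h g′ X + act h g (D F * X) := by
  induction g using MvPolynomial.induction_on generalizing X with
  | C a =>
    rw [deriv_mvPolynomial_C, act_C, act_C, act_C, ← mul_assoc, D_mul_const, add_mul, mul_assoc,
      add_comm]
  | add p q hp hq =>
    rw [act_add, map_add Differential.deriv, act_add, act_add, mul_add, hp, hq]
    abel
  | mul_X p i hp =>
    rw [Derivation.leibniz, deriv_mvPolynomial_X, smul_zero, zero_add, smul_eq_mul,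
      mul_comm (MvPolynomial.X i), act_mul, act_mul, act_mul, hp, act_X, act_X, mul_assoc]

/-- `C[λ, μ₁, μ₂]` acts by multiplication on the right. -/
theorem act_map_eq_mul (g : MvPolynomial (Fin 3) (constants F)) (X : DiffOp F) :
    act h (MvPolynomial.map (constants F).subtype g) X
      = X * act h (MvPolynomial.map (constants F).subtype g) 1 := by
  induction g using MvPolynomial.induction_on generalizing X with
  | C a =>
    rw [MvPolynomial.map_C, act_C, act_C, mul_one]
    exact Algebra.commutes (A := DiffOp F) a X
  | add p q hp hq => rw [map_add, act_add, act_add, hp X, hq X, mul_add]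
  | mul_X p i hp =>
    rw [_root_.map_mul, MvPolynomial.map_X, act_mul, act_mul, hp, act_X, hp (act h _ 1), act_X]
    simp only [mul_assoc, one_mul]

theorem evalOps_eq_act (g : MvPolynomial (Fin 3) (constants F)) :
    evalOps L A₁ A₂ g = act h (MvPolynomial.map (constants F).subtype g) 1 := by
  conv_rhs => rw [← MvPolynomial.support_sum_monomial_coeff g]
  rw [map_sum, act_sum]
  refine Finset.sum_congr rfl fun α _ => ?_
  rw [MvPolynomial.map_monomial, act_monomial, one_mul, constants_smul_eq]
  rfl

theorem act_map (g : MvPolynomial (Fin 3) (constants F)) (X : DiffOp F) :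
    act h (MvPolynomial.map (constants F).subtype g) X = X * evalOps L A₁ A₂ g := by
  rw [act_map_eq_mul, evalOps_eq_act h]

theorem evalOps_sub (h : IsCommutingTriple L A₁ A₂) (g g' : MvPolynomial (Fin 3) (constants F)) :
    evalOps L A₁ A₂ (g - g') = evalOps L A₁ A₂ g - evalOps L A₁ A₂ g' := by
  rw [evalOps_eq_act h, map_sub, act_sub, ← evalOps_eq_act h, ← evalOps_eq_act h]

theorem evalOps_mul (h : IsCommutingTriple L A₁ A₂) (g g' : MvPolynomial (Fin 3) (constants F)) :
    evalOps L A₁ A₂ (g * g') = evalOps L A₁ A₂ g * evalOps L A₁ A₂ g' := by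
  rw [mul_comm g, evalOps_eq_act h (g' * g), _root_.map_mul, act_mul, act_map, act_map, one_mul]

theorem evalOps_C (h : IsCommutingTriple L A₁ A₂) (c : constants F) :
    evalOps L A₁ A₂ (MvPolynomial.C c) = const (c : F) := by
  rw [evalOps_eq_act h, MvPolynomial.map_C, act_C, mul_one]
  rfl

theorem evalOps_X (h : IsCommutingTriple L A₁ A₂) (i : Fin 3) :
    evalOps L A₁ A₂ (MvPolynomial.X i) = ![L, A₁, A₂] i := by
  rw [evalOps_eq_act h, MvPolynomial.map_X, act_X, one_mul]

theorem evalOps_mem_centralizerOp (h : IsCommutingTriple L A₁ A₂)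
    (g : MvPolynomial (Fin 3) (constants F)) : evalOps L A₁ A₂ g ∈ centralizerOp L := by
  refine Subalgebra.sum_mem _ fun α _ => Subalgebra.smul_mem _ ?_ _
  exact Subalgebra.mul_mem _ (Subalgebra.mul_mem _
    (Subalgebra.pow_mem _ (self_mem_centralizerOp L) _) (Subalgebra.pow_mem _ h.left _))
    (Subalgebra.pow_mem _ h.right _)

theorem deriv_map_constants {σ : Type*} (g : MvPolynomial σ (constants F)) :
    (MvPolynomial.map (constants F).subtype g)′ = 0 := by
  ext m
  rw [coeff_deriv_mvPolynomial, MvPolynomial.coeff_map, MvPolynomial.coeff_zero]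
  exact (g.coeff m).2

/-- The ideal generated by `BC(L)` is already a differential ideal. -/
theorem diffBC_eq_span (L A₁ A₂ : DiffOp F) : diffBC L A₁ A₂
    = Ideal.span (MvPolynomial.map (constants F).subtype '' BC L A₁ A₂) := by
  apply le_antisymm
  · refine sInf_le ⟨Ideal.subset_span, fun x hx => ?_⟩
    induction hx using Submodule.span_induction with
    | mem x hx =>
      obtain ⟨g, -, rfl⟩ := hx
      -- The generators have constant coefficients, so they are killed by the derivation.
      rw [deriv_map_constants]
      exact Ideal.zero_mem _
    | zero => rw [map_zero]; exact Ideal.zero_mem _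
    | add x y _ _ hx hy => rw [map_add]; exact Ideal.add_mem _ hx hy
    | smul a x hx hx' =>
      rw [smul_eq_mul, Derivation.leibniz]
      exact Ideal.add_mem _ (Ideal.mul_mem_left _ _ hx')
        (Ideal.mul_mem_right _ _ hx)
  · rw [Ideal.span_le]
    exact fun x hx => Ideal.mem_sInf.mpr fun {I} hI => hI.1 hx

theorem act_eq_zero_of_mem_diffBC {g : MvPolynomial (Fin 3) F} (hg : g ∈ diffBC L A₁ A₂)
    (X : DiffOp F) : act h g X = 0 := by
  have hle : diffBC L A₁ A₂ ≤ RingHom.ker (act h) := by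
    rw [diffBC_eq_span, Ideal.span_le]
    rintro _ ⟨g, hg, rfl⟩
    change act h _ = 0
    ext1 X
    rw [act_map, show evalOps L A₁ A₂ g = 0 from hg, mul_zero]
    rfl
  have h0 : act h g = 0 := hle hg
  rw [h0]
  rfl

/-- The span over `Σ` of the polynomials with constant coefficients whose value at `(L, A₁, A₂)`
has degree less than `n`. -/
def spanDegreeLT (L A₁ A₂ : DiffOp F) (n : ℕ) : Submodule F (MvPolynomial (Fin 3) F) :=
  Submodule.span F
    (MvPolynomial.map (constants F).subtype '' {g | (evalOps L A₁ A₂ g).degree < n})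

theorem spanDegreeLT_mono {m n : ℕ} (hmn : m ≤ n) :
    spanDegreeLT L A₁ A₂ m ≤ spanDegreeLT L A₁ A₂ n :=
  Submodule.span_mono (Set.image_mono fun _ hg =>
    lt_of_lt_of_le (Set.mem_ofPred_eq ▸ hg) (by exact_mod_cast hmn))

theorem exists_mem_spanDegreeLT (g : MvPolynomial (Fin 3) F) : ∃ n, g ∈ spanDegreeLT L A₁ A₂ n := by
  induction g using MvPolynomial.induction_on' with
  | monomial α a =>
    refine ⟨(evalOps L A₁ A₂ (MvPolynomial.monomial α 1)).order + 1, ?_⟩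
    have : MvPolynomial.monomial α a
        = a • MvPolynomial.map (constants F).subtype (MvPolynomial.monomial α 1) := by
      rw [MvPolynomial.map_monomial, MvPolynomial.smul_monomial]
      simp
    rw [this]
    exact Submodule.smul_mem _ _ (Submodule.subset_span ⟨_,
      (degree_le_order _).trans_lt (by norm_cast; omega), rfl⟩)
  | add p q hp hq =>
    obtain ⟨n, hn⟩ := hp
    obtain ⟨m, hm⟩ := hq
    exact ⟨max n m, Submodule.add_mem _ (spanDegreeLT_mono (le_max_left n m) hn)
      (spanDegreeLT_mono (le_max_right n m) hm)⟩

/-- Degree below `0` means the zero operator, so the generators at this level are those of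
`[BC(L)]`. -/
theorem spanDegreeLT_zero_le :
    spanDegreeLT L A₁ A₂ 0 ≤ (diffBC L A₁ A₂).restrictScalars F := by
  rw [spanDegreeLT, Submodule.span_le]
  rintro _ ⟨g, hg, rfl⟩
  rw [diffBC_eq_span]
  refine Ideal.subset_span ⟨g, ?_, rfl⟩
  have hg' : (evalOps L A₁ A₂ g).degree < (0 : ℕ) := hg
  change evalOps L A₁ A₂ g = 0
  ext i
  exact degree_lt_iff.mp hg' i (Nat.zero_le i)

theorem act_smul (a : F) (g : MvPolynomial (Fin 3) F) (X : DiffOp F) :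
    act h (a • g) X = const a * act h g X := by
  rw [MvPolynomial.smul_eq_C_mul, act_mul, act_C]

theorem degree_act_lt {n : ℕ} {g : MvPolynomial (Fin 3) F} (hg : g ∈ spanDegreeLT L A₁ A₂ n)
    {X : DiffOp F} (hX : X ≠ 0) : (act h g X).degree < (X.order + n : ℕ) := by
  induction hg using Submodule.span_induction with
  | mem x hx =>
    obtain ⟨g, hg, rfl⟩ := hx
    rw [act_map, degree_mul, degree_eq_order hX, Nat.cast_add]
    exact WithBot.add_lt_add_left (by simp) hg
  | zero => rw [act_zero, degree_zero]; exact WithBot.bot_lt_coe _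
  | add x y _ _ hx hy =>
    rw [act_add]
    exact (degree_add_le _ _).trans_lt (max_lt hx hy)
  | smul a x _ hx =>
    rw [act_smul]
    exact (degree_const_mul_le _ _).trans_lt hx

variable [CharZero F]

/-- Consecutive levels of the filtration differ by at most one dimension over `Σ`, because operators
of equal order in the centralizer have leading coefficients in constant ratio. -/
theorem exists_sub_smul_mem_spanDegreeLT (h : IsCommutingTriple L A₁ A₂) (hL : L.order = 3) {n : ℕ}
    {H : MvPolynomial (Fin 3) (constants F)} (hH : (evalOps L A₁ A₂ H).degree = n)
    {g : MvPolynomial (Fin 3) F} (hg : g ∈ spanDegreeLT L A₁ A₂ (n + 1)) :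
    ∃ a : F, g - a • MvPolynomial.map (constants F).subtype H ∈ spanDegreeLT L A₁ A₂ n := by
  induction hg using Submodule.span_induction with
  | mem x hx =>
    obtain ⟨g, hg, rfl⟩ := hx
    have hord : (evalOps L A₁ A₂ H).order = n := order_eq_of_degree_eq hH
    have hg' : (evalOps L A₁ A₂ g).degree ≤ n := by
      rw [degree_le_iff]
      exact fun i hi => degree_lt_iff.mp hg i (by exact_mod_cast hi)
    obtain ⟨c, hc⟩ := exists_degree_sub_smul_lt hL (evalOps_mem_centralizerOp h H)
      (evalOps_mem_centralizerOp h g)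
      (fun h0 => by rw [h0, degree_zero] at hH; exact WithBot.bot_ne_coe hH) (by rwa [hord])
    refine ⟨c, Submodule.subset_span ⟨g - MvPolynomial.C c * H, ?_, ?_⟩⟩
    · change (evalOps L A₁ A₂ (g - MvPolynomial.C c * H)).degree < n
      rwa [evalOps_sub h, evalOps_mul h, evalOps_C h, ← constants_smul_eq, ← hord]
    · rw [map_sub, _root_.map_mul, MvPolynomial.map_C, MvPolynomial.smul_eq_C_mul]
      rfl
  | zero => exact ⟨0, by simp⟩
  | add x y _ _ hx hy =>
    obtain ⟨a, ha⟩ := hx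
    obtain ⟨b, hb⟩ := hy
    refine ⟨a + b, ?_⟩
    rw [add_smul, add_sub_add_comm]
    exact Submodule.add_mem _ ha hb
  | smul a x _ hx =>
    obtain ⟨b, hb⟩ := hx
    refine ⟨a * b, ?_⟩
    rw [mul_smul, ← smul_sub]
    exact Submodule.smul_mem _ _ hb

/-- `Σ[∂]` is a torsion-free module over `Σ[λ, μ₁, μ₂] / [BC(L)]`. -/
theorem mem_diffBC_of_act_eq_zero (hL : L.order = 3) {g : MvPolynomial (Fin 3) F} {X : DiffOp F}
    (hX : X ≠ 0) (hg : act h g X = 0) : g ∈ diffBC L A₁ A₂ := by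
  -- Induction along the filtration, removing the leading term of `g` at each level.
  have key : ∀ n : ℕ, ∀ g ∈ spanDegreeLT L A₁ A₂ n, act h g X = 0 → g ∈ diffBC L A₁ A₂ := by
    intro n
    induction n with
    | zero => exact fun g hg _ => spanDegreeLT_zero_le hg
    | succ n ih =>
      intro g hg hgX
      by_cases hex : ∃ H : MvPolynomial (Fin 3) (constants F), (evalOps L A₁ A₂ H).degree = n
      · obtain ⟨H, hH⟩ := hex
        obtain ⟨a, ha⟩ := exists_sub_smul_mem_spanDegreeLT h hL hH hg
        have hdeg := degree_act_lt h ha hX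
        rw [act_sub, hgX, zero_sub, act_smul, act_map] at hdeg
        -- If `a ≠ 0`, the term `a * X * H(L, A₁, A₂)` has degree exactly `ord X + n`, which the
        -- lower part of `g` cannot cancel.
        by_cases ha0 : a = 0
        · rw [ha0, zero_smul, sub_zero] at ha
          exact ih g ha hgX
        · exfalso
          rw [← neg_mul, ← map_neg, degree_mul, degree_mul, degree_const (neg_ne_zero.mpr ha0),
            hH, degree_eq_order hX, zero_add, ← Nat.cast_add] at hdeg
          exact lt_irrefl _ hdeg
      -- No value has degree exactly `n`, so the filtration does not grow at this level.
      · refine ih g (Submodule.span_mono (Set.image_mono fun G hG => ?_) hg) hgX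
        have hG' : (evalOps L A₁ A₂ G).degree ≤ n := by
          rw [degree_le_iff]
          exact fun i hi => degree_lt_iff.mp hG i (by exact_mod_cast hi)
        exact lt_of_le_of_ne hG' fun he => hex ⟨G, he⟩
  obtain ⟨n, hn⟩ := exists_mem_spanDegreeLT (L := L) (A₁ := A₁) (A₂ := A₂) g
  exact key n g hn hg

/-- If `g g'` acts by zero, then either `g'` kills `1`, or `g` kills the nonzero operator `g' · 1`;
torsion-freeness settles both cases. -/
theorem isPrime_diffBC (h : IsCommutingTriple L A₁ A₂) (hL : L.order = 3) : (diffBC L A₁ A₂).IsPrime := by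
  refine ⟨fun htop => ?_, fun {g g'} hgg => ?_⟩
  · have h1 : (1 : MvPolynomial (Fin 3) F) ∈ diffBC L A₁ A₂ := htop ▸ Submodule.mem_top
    have := act_eq_zero_of_mem_diffBC h h1 1
    rw [act_one] at this
    exact one_ne_zero this
  · by_cases h0 : act h g' 1 = 0
    · exact Or.inr (mem_diffBC_of_act_eq_zero h hL one_ne_zero h0)
    · have := act_eq_zero_of_mem_diffBC h hgg 1
      rw [act_mul] at this
      exact Or.inl (mem_diffBC_of_act_eq_zero h hL h0 this)

end Action

/-! ### `Σ[∂]` as a module over `Σ[λ]`; rank one over the spectral curve. -/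

section PolynomialAction

variable {F : Type*} [Field F] [Differential F] {L A₁ A₂ : DiffOp F}

variable (F) in
/-- The embedding of `Σ[λ]` into `Σ[λ, μ₁, μ₂]`. -/
def lam : Polynomial F →+* MvPolynomial (Fin 3) F :=
  Polynomial.eval₂RingHom MvPolynomial.C (MvPolynomial.X 0)

theorem lam_monomial (j : ℕ) (a : F) :
    lam F (Polynomial.monomial j a) = MvPolynomial.C a * MvPolynomial.X 0 ^ j :=
  Polynomial.eval₂_monomial _ _

variable (h : IsCommutingTriple L A₁ A₂)

theorem act_X_zero_pow (j : ℕ) (X : DiffOp F) :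
    act h (MvPolynomial.X 0 ^ j) X = X * L ^ j := by
  induction j generalizing X with
  | zero => rw [pow_zero, act_one, pow_zero, mul_one]
  | succ j ih => rw [pow_succ, act_mul, act_X, ih, pow_succ', ← mul_assoc]; rfl

theorem act_lam_monomial (j : ℕ) (a : F) (X : DiffOp F) :
    act h (lam F (Polynomial.monomial j a)) X = const a * (X * L ^ j) := by
  rw [lam_monomial, act_mul, act_C, act_X_zero_pow]

theorem act_lam_add (p q : Polynomial F) (X : DiffOp F) :
    act h (lam F (p + q)) X = act h (lam F p) X + act h (lam F q) X := by
  rw [map_add, act_add]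

theorem act_lam_mul (p q : Polynomial F) (X : DiffOp F) :
    act h (lam F (p * q)) X = act h (lam F p) (act h (lam F q) X) := by
  rw [_root_.map_mul, act_mul]

theorem act_lam_eq_sum (p : Polynomial F) {n : ℕ} (hn : p.natDegree < n) (X : DiffOp F) :
    act h (lam F p) X = ∑ j ∈ Finset.range n, const (p.coeff j) * (X * L ^ j) := by
  conv_lhs => rw [p.as_sum_range' n hn]
  rw [map_sum, act_sum]
  exact Finset.sum_congr rfl fun j _ => act_lam_monomial h j _ X

theorem act_map_add_right (g : MvPolynomial (Fin 3) F) (X Y : DiffOp F) :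
    act h g (X + Y) = act h g X + act h g Y := map_add _ X Y

theorem act_sum_right {ι : Type*} (s : Finset ι) (g : MvPolynomial (Fin 3) F)
    (f : ι → DiffOp F) : act h g (∑ i ∈ s, f i) = ∑ i ∈ s, act h g (f i) := map_sum _ f s

/-- The operators `1, ∂, ∂²` generate `Σ[∂]` over `Σ[λ]`. -/
theorem exists_eq_sum_act_lam (hL : L.order = 3) (X : DiffOp F) :
    ∃ β : Fin 3 → Polynomial F, X = ∑ i, act h (lam F (β i)) (D F ^ (i : ℕ)) := by
  have hl : L.coeff L.order ≠ 0 := coeff_order_ne_zero (ne_zero_of_order_eq hL)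
  have key : ∀ (n : ℕ) (X : DiffOp F), X.degree < n →
      ∃ β : Fin 3 → Polynomial F, X = ∑ i, act h (lam F (β i)) (D F ^ (i : ℕ)) := by
    intro n
    induction n with
    | zero =>
      intro X hX
      refine ⟨0, ?_⟩
      have : X = 0 := by ext i; exact degree_lt_iff.mp hX i (Nat.zero_le i)
      simp only [this, Pi.zero_apply, map_zero]
      simp
    | succ n ih =>
      intro X hX
      have hX' : X.degree ≤ n := by
        rw [degree_le_iff]
        exact fun i hi => degree_lt_iff.mp hX i (by exact_mod_cast hi)
      -- The operator `∂ᵏ Lʲ` with `n = k + 3 j` has order `n` and serves to remove the leading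
      -- term.
      set k : Fin 3 := ⟨n % 3, Nat.mod_lt _ (by norm_num)⟩ with hk
      set j := n / 3
      have hkj : (k : ℕ) + j * 3 = n := by simp only [hk, j]; omega
      have hLj : (L ^ j).order = j * 3 := by rw [order_pow (ne_zero_of_order_eq hL), hL]
      have hLj0 : (L ^ j).coeff (j * 3) ≠ 0 :=
        hLj ▸ coeff_order_ne_zero (pow_ne_zero j (ne_zero_of_order_eq hL))
      set a := X.coeff n / (L ^ j).coeff (j * 3)
      have hD : (D F ^ (k : ℕ)).degree ≤ (k : ℕ) := (degree_D_pow _).le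
      have hLd : (L ^ j).degree ≤ (j * 3 : ℕ) := hLj ▸ degree_le_order (L ^ j)
      have hE : (D F ^ (k : ℕ) * L ^ j).degree ≤ n := by
        rw [← hkj]
        exact degree_mul_le_of_le hD hLd
      have hEc : (D F ^ (k : ℕ) * L ^ j).coeff n = (L ^ j).coeff (j * 3) := by
        rw [← hkj, coeff_mul_top hD hLd, coeff_D_pow, if_pos rfl, one_mul]
      obtain ⟨β, hβ⟩ := ih (X - const a * (D F ^ (k : ℕ) * L ^ j))
        (degree_sub_lt_of_coeff hX' ((degree_const_mul_le _ _).trans hE)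
          (by rw [coeff_const_mul, hEc, div_mul_cancel₀ _ hLj0]))
      refine ⟨β + Pi.single k (Polynomial.monomial j a), ?_⟩
      simp only [Pi.add_apply, act_lam_add, Finset.sum_add_distrib]
      rw [← hβ, Finset.sum_eq_single k, Pi.single_eq_same, act_lam_monomial, sub_add_cancel]
      · intro i _ hi
        rw [Pi.single_eq_of_ne hi, map_zero, act_zero]
      · simp
  exact key (X.order + 1) X ((degree_le_order X).trans_lt (by norm_cast; omega))

/-- Change of coordinates in the `Σ[λ]`-module `Σ[∂]`. It turns a singular matrix into a linear
relation, and an adjugate into Cramer's rule. -/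
theorem sum_act_lam_mulVec (M : Matrix (Fin 3) (Fin 3) (Polynomial F)) (v : Fin 3 → Polynomial F) :
    ∑ k, act h (lam F (v k)) (∑ i, act h (lam F (M i k)) (D F ^ (i : ℕ)))
      = ∑ i, act h (lam F (M.mulVec v i)) (D F ^ (i : ℕ)) := by
  simp only [Matrix.mulVec, dotProduct, map_sum (lam F), act_sum, act_sum_right, _root_.map_mul,
    ← act_mul]
  simp only [← _root_.map_mul]
  rw [Finset.sum_comm]
  simp only [mul_comm]

/-- The terms `Bᵏ Lʲ` have orders `k * ord B + 3 j`, pairwise distinct for `k < 3` since `ord B` is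
invertible mod 3. -/
theorem eq_zero_of_sum_act_lam_pow_of_not_dvd (hL : L.order = 3) {B : DiffOp F}
    (hB : ¬ 3 ∣ B.order) {v : Fin 3 → Polynomial F}
    (hv : ∑ k, act h (lam F (v k)) (B ^ (k : ℕ)) = 0) : v = 0 := by
  have hL0 := ne_zero_of_order_eq hL
  have hB0 : B ≠ 0 := by
    rintro rfl
    exact hB (by rw [order_zero]; exact dvd_zero 3)
  set n := (Finset.univ.sup fun k => (v k).natDegree) + 1
  have hn : ∀ k, (v k).natDegree < n := fun k =>
    Nat.lt_succ_of_le (Finset.le_sup (f := fun k => (v k).natDegree) (Finset.mem_univ k))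
  set f : Fin 3 × ℕ → DiffOp F := fun x =>
    const ((v x.1).coeff x.2) * (B ^ (x.1 : ℕ) * L ^ x.2) with hf
  have hsum : ∑ x ∈ Finset.univ ×ˢ Finset.range n, f x = 0 := by
    rw [← hv, Finset.sum_product]
    exact Finset.sum_congr rfl fun k _ =>
      (act_lam_eq_sum h (v k) (hn k) (B ^ (k : ℕ))).symm
  have hord : ∀ x, f x ≠ 0 → (f x).order = x.1 * B.order + x.2 * 3 := by
    intro x hx
    rw [order_mul (left_ne_zero_of_mul hx) (right_ne_zero_of_mul hx),
      order_mul (pow_ne_zero _ hB0) (pow_ne_zero _ hL0), order_pow hB0, order_pow hL0, hL,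
      show (const ((v x.1).coeff x.2)).order = 0 from Polynomial.natDegree_C _, zero_add]
  ext k j
  by_contra hkj
  rw [Pi.zero_apply, Polynomial.coeff_zero] at hkj
  refine sum_ne_zero_of_order_injOn (s := Finset.univ ×ˢ Finset.range n) (f := f) ?_
    (i := (k, j)) ?_ ?_ hsum
  · rintro ⟨k, i⟩ _ ⟨l, j⟩ _ hi hj hij
    rw [hord _ hi, hord _ hj] at hij
    have hkl : k = l := by
      rcases (show B.order % 3 = 1 ∨ B.order % 3 = 2 by omega) with hm | hm <;>
      fin_cases k <;> fin_cases l <;> first | rfl | (exfalso; simp at hij; omega)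
    subst hkl
    simp only at hij
    rw [show i = j by omega]
  · refine Finset.mem_product.mpr ⟨Finset.mem_univ _, Finset.mem_range.mpr ?_⟩
    exact (Polynomial.le_natDegree_of_ne_zero hkj).trans_lt (hn k)
  · refine mul_ne_zero (fun h0 => hkj ?_) (mul_ne_zero (pow_ne_zero _ hB0) (pow_ne_zero _ hL0))
    rw [← degree_eq_bot] at h0
    by_contra hne
    rw [degree_const hne] at h0
    exact WithBot.coe_ne_bot h0

theorem act_lam_map (p : Polynomial (constants F)) (X : DiffOp F) :
    act h (lam F (p.map (constants F).subtype)) X = X * Polynomial.aeval L p := by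
  induction p using Polynomial.induction_on' generalizing X with
  | add p q hp hq => rw [Polynomial.map_add, map_add, act_add, hp, hq, map_add, mul_add]
  | monomial j c =>
    rw [Polynomial.map_monomial, act_lam_monomial, Polynomial.aeval_monomial, ← mul_assoc,
      ← mul_assoc]
    congr 1
    exact Algebra.commutes (A := DiffOp F) c X

variable [CharZero F]

/-- If `B` is in the centralizer but not in `C[L]`, then `1, B, B²` are linearly independent over
`Σ[λ]`. -/
theorem eq_zero_of_sum_act_lam_pow (hL : L.order = 3) {B : DiffOp F} (hB : B ∈ centralizerOp L)
    (hB' : B ∉ polysIn L) {v : Fin 3 → Polynomial F}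
    (hv : ∑ k, act h (lam F (v k)) (B ^ (k : ℕ)) = 0) : v = 0 := by
  obtain ⟨p, hp⟩ := exists_not_dvd_order_sub hL hB hB'
  set P := Polynomial.aeval L p with hP
  set q := p.map (constants F).subtype
  set B₀ := B - P with hB₀
  -- `P` is a polynomial in `L` with constant coefficients, and `L` commutes with `B₀`.
  have hPB : Commute P B₀ := by
    have hPZ : P ∈ polysIn L := mem_polysIn.mpr ⟨p, rfl⟩
    have hLB : Commute L B₀ := mem_centralizerOp.mp
      (Subalgebra.sub_mem _ hB (polysIn_le_centralizerOp L hPZ))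
    clear_value P
    clear hB₀ hP hp
    revert hLB
    generalize B₀ = Y
    intro hLB
    induction hPZ using Algebra.adjoin_induction with
    | mem x hx => rw [Set.mem_singleton_iff.mp hx]; exact hLB
    | algebraMap c => exact Algebra.commutes c Y
    | add x y _ _ hx hy => exact hx.add_left hy
    | mul x y _ _ hx hy => exact hx.mul_left hy
  have hBe : B = B₀ + P := by rw [hB₀, sub_add_cancel]
  have hB2 : B ^ 2 = B₀ ^ 2 + 2 * (B₀ * P) + P * P := by
    rw [hBe, pow_two, mul_add, add_mul, add_mul, hPB.eq, pow_two]
    noncomm_ring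
  -- Substituting `B = B₀ + P`, where right multiplication by `P` is the scalar `q` of `Σ[λ]`,
  -- changes the coefficients by a unitriangular matrix.
  have h1 : ∑ k, act h (lam F ((![v 0 + v 1 * q + v 2 * (q * q), v 1 + 2 * (v 2 * q), v 2] :
      Fin 3 → Polynomial F) k)) (B₀ ^ (k : ℕ)) = 0 := by
    rw [← hv]
    have hq : ∀ X, act h (lam F q) X = X * P := act_lam_map h p
    simp only [Fin.sum_univ_three, Matrix.cons_val_zero, Matrix.cons_val_one, Matrix.cons_val,
      Fin.val_zero, Fin.val_one, Fin.val_two, pow_zero, pow_one, two_mul, act_lam_add, act_lam_mul,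
      hq, hB2]
    rw [hBe]
    simp only [act_map_add_right, one_mul]
    abel
  have h2 := eq_zero_of_sum_act_lam_pow_of_not_dvd h hL hp h1
  have e2 : v 2 = 0 := congrFun h2 2
  have e1 : v 1 + 2 * (v 2 * q) = 0 := congrFun h2 1
  have e0 : v 0 + v 1 * q + v 2 * (q * q) = 0 := congrFun h2 0
  have e1' : v 1 = 0 := by simpa [e2] using e1
  have e0' : v 0 = 0 := by simpa [e2, e1'] using e0
  funext k
  fin_cases k
  exacts [e0', e1', e2]

/-- The matrix of `1, B, B²` with respect to `1, ∂, ∂²`, over `Σ[λ]`, has a nonzero determinant. -/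
theorem exists_matrix_pow (hL : L.order = 3) {B : DiffOp F} (hB : B ∈ centralizerOp L)
    (hB' : B ∉ polysIn L) : ∃ M : Matrix (Fin 3) (Fin 3) (Polynomial F), M.det ≠ 0 ∧
      ∀ k : Fin 3, B ^ (k : ℕ) = ∑ i, act h (lam F (M i k)) (D F ^ (i : ℕ)) := by
  choose β hβ using fun k : Fin 3 => exists_eq_sum_act_lam h hL (B ^ (k : ℕ))
  refine ⟨Matrix.of fun i k => β k i, fun hdet => ?_, hβ⟩
  obtain ⟨v, hv0, hv⟩ := Matrix.exists_mulVec_eq_zero_iff.mpr hdet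
  refine hv0 (eq_zero_of_sum_act_lam_pow h hL hB hB' ?_)
  have := sum_act_lam_mulVec h (Matrix.of fun i k => β k i) v
  rw [hv] at this
  simp only [Matrix.of_apply, ← hβ, Pi.zero_apply, map_zero] at this
  rw [this]
  exact Finset.sum_eq_zero fun i _ => act_zero h _

/-- Applied to `1`, the polynomial gives `∑ pⱼ Lʲ`, whose terms have distinct orders. Hence nonzero
determinants over `Σ[λ]` remain nonzero in `Σ(Γ)`. -/
theorem lam_notMem_diffBC (h : IsCommutingTriple L A₁ A₂) (hL : L.order = 3) {p : Polynomial F} (hp : p ≠ 0) :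
    lam F p ∉ diffBC L A₁ A₂ := by
  intro hmem
  have hL0 := ne_zero_of_order_eq hL
  have h0 := act_eq_zero_of_mem_diffBC h hmem 1
  rw [act_lam_eq_sum h p (Nat.lt_succ_self _)] at h0
  refine sum_ne_zero_of_order_injOn ?_ (Finset.self_mem_range_succ p.natDegree) ?_ h0
  · intro i _ j _ hi hj hij
    have hord : ∀ i : ℕ, const (p.coeff i) * (1 * L ^ i) ≠ 0 →
        (const (p.coeff i) * (1 * L ^ i)).order = i * 3 := by
      intro i hi
      rw [order_mul (left_ne_zero_of_mul hi) (right_ne_zero_of_mul hi), one_mul, order_pow hL0, hL,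
        show (const (p.coeff i)).order = 0 from Polynomial.natDegree_C _, zero_add]
    rw [hord i hi, hord j hj] at hij
    omega
  · refine mul_ne_zero (fun h1 => ?_) (mul_ne_zero one_ne_zero (pow_ne_zero _ hL0))
    rw [← degree_eq_bot, degree_const (show p.coeff p.natDegree ≠ 0 by simpa using hp)] at h1
    exact WithBot.coe_ne_bot h1

/-- The `Σ[λ, μ₁, μ₂]`-module `Σ[∂]` has rank one. -/
theorem exists_act_eq_act_one (hL : L.order = 3) {b : MvPolynomial (Fin 3) (constants F)}
    (hb : evalOps L A₁ A₂ b ∉ polysIn L) (X : DiffOp F) :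
    ∃ s r : MvPolynomial (Fin 3) F, s ∉ diffBC L A₁ A₂ ∧ act h s X = act h r 1 := by
  obtain ⟨M, hdet, hM⟩ := exists_matrix_pow h hL (evalOps_mem_centralizerOp h b) hb
  obtain ⟨β, hβ⟩ := exists_eq_sum_act_lam h hL X
  -- Cramer's rule: `det M` times `X` is a combination of `1, B, B²`, and `Bᵏ = bᵏ · 1`.
  refine ⟨lam F M.det, ∑ k, lam F (M.adjugate.mulVec β k)
    * MvPolynomial.map (constants F).subtype b ^ (k : ℕ), lam_notMem_diffBC h hL hdet, ?_⟩
  have hpow : ∀ n : ℕ, act h (MvPolynomial.map (constants F).subtype b ^ n) 1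
      = evalOps L A₁ A₂ b ^ n := by
    intro n
    induction n with
    | zero => rw [pow_zero, act_one, pow_zero]
    | succ n ih => rw [pow_succ', act_mul, ih, act_map, pow_succ]
  have h1 := sum_act_lam_mulVec h M (M.adjugate.mulVec β)
  rw [Matrix.mulVec_mulVec, Matrix.mul_adjugate, Matrix.smul_mulVec, Matrix.one_mulVec] at h1
  simp only [← hM] at h1
  rw [act_sum]
  simp only [act_mul, hpow]
  rw [h1]
  conv_lhs => rw [hβ]
  rw [act_sum_right]
  simp only [Pi.smul_apply, smul_eq_mul, _root_.map_mul]
  simp only [← act_mul, ← _root_.map_mul]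

end PolynomialAction

/-! ### Right divisibility as membership in left ideals. -/

section RightDivision

variable {K : Type*} [Field K] [Differential K]

/-- Over a noncommutative ring `Ideal` means left ideal, which is the notion that matches right
factors. -/
theorem rightDvd_iff {G P : DiffOp K} : RightDvd G P ↔ P ∈ Ideal.span {G} := by
  rw [Ideal.mem_span_singleton']
  exact ⟨fun ⟨N, h⟩ => ⟨N, h.symm⟩, fun ⟨N, h⟩ => ⟨N, h.symm⟩⟩

theorem const_eq_zero {c : K} : const c = 0 ↔ c = 0 := by
  refine ⟨fun h => ?_, fun h => by rw [h, map_zero]⟩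
  have := coeff_const c 0
  rwa [h, coeff_zero, if_pos rfl, eq_comm] at this

theorem const_commute {c : K} (hc : c′ = 0) (P : DiffOp K) : Commute (const c) P := by
  induction P using induction_left with
  | one => exact Commute.one_right _
  | add P Q hP hQ => exact hP.add_right hQ
  | const_mul a P hP =>
    refine Commute.mul_right ?_ hP
    change const c * const a = const a * const c
    rw [← _root_.map_mul, ← _root_.map_mul, mul_comm]
  | D_mul P hP =>
    refine Commute.mul_right ?_ hP
    change const c * D K = D K * const c
    rw [D_mul_const, hc, map_zero, add_zero]

theorem eq_zero_of_mem_span_of_degree_lt {G P : DiffOp K} (h : P ∈ Ideal.span {G})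
    (hd : P.degree < G.degree) : P = 0 := by
  obtain ⟨N, rfl⟩ := Ideal.mem_span_singleton'.mp h
  by_contra h0
  rw [degree_mul, degree_eq_order (left_ne_zero_of_mul h0),
    degree_eq_order (right_ne_zero_of_mul h0), ← Nat.cast_add] at hd
  have : N.order + G.order < G.order := by exact_mod_cast hd
  omega

theorem degree_D_add_const (φ : K) : (D K + const φ).degree = 1 := by
  refine degree_eq_of_coeff (n := 1) ?_ ?_
  · rw [← pow_one (D K)]
    exact (degree_add_le _ _).trans (max_le (degree_D_pow 1).le
      ((degree_const_le φ).trans (by norm_num)))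
  · rw [coeff_add, coeff_const, ← pow_one (D K), coeff_D_pow]
    simp

theorem eq_zero_of_const_mem_span {φ c : K} (h : const c ∈ Ideal.span {D K + const φ}) : c = 0 := by
  refine const_eq_zero.mp (eq_zero_of_mem_span_of_degree_lt h ?_)
  rw [degree_D_add_const]
  exact (degree_const_le c).trans_lt (by norm_num)

end RightDivision

/-! ### The right factor `∂ + φ`, and independence modulo `L - λ`. -/

section SpectralField

variable {F : Type*} [Field F] [Differential F] {L A₁ A₂ : DiffOp F}
  (h : IsCommutingTriple L A₁ A₂) {K : Type*} [Field K] [Differential K]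
  {τ : MvPolynomial (Fin 3) F →+* K}

theorem map_C_comp_deriv (hτ : ∀ g, τ g′ = (τ g)′) (a : F) :
    (τ.comp MvPolynomial.C) a′ = ((τ.comp MvPolynomial.C) a)′ := by
  rw [RingHom.comp_apply, RingHom.comp_apply, ← hτ, deriv_mvPolynomial_C]

theorem deriv_map_constants_eq_zero (hτ : ∀ g, τ g′ = (τ g)′)
    (g : MvPolynomial (Fin 3) (constants F)) :
    (τ (MvPolynomial.map (constants F).subtype g))′ = 0 := by
  rw [← hτ, deriv_map_constants, map_zero]

theorem deriv_map_X_eq_zero (hτ : ∀ g, τ g′ = (τ g)′) (i : Fin 3) :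
    (τ (MvPolynomial.X i))′ = 0 := by
  rw [← hτ, deriv_mvPolynomial_X, map_zero]

/-- Over the field of the spectral curve, every operator is congruent to a function modulo the left
ideal of `∂ + φ`; the function is given by the action of `Σ[λ, μ₁, μ₂]` on `Σ[∂]`. -/
theorem exists_congr_const (hτ : ∀ g, τ g′ = (τ g)′) (hker : ∀ g, τ g = 0 ↔ g ∈ diffBC L A₁ A₂)
    {s₀ r₀ : MvPolynomial (Fin 3) F} (hs₀ : s₀ ∉ diffBC L A₁ A₂)
    (h₀ : act h s₀ (D F) = act h r₀ 1) (X : DiffOp F) :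
    ∃ (s r : MvPolynomial (Fin 3) F) (c : K), τ s ≠ 0 ∧ act h s X = act h r 1 ∧
      map (τ.comp MvPolynomial.C) X - const c ∈ Ideal.span {D K + const (-(τ r₀ / τ s₀))} ∧
      τ s * c = τ r := by
  have hs₀' : τ s₀ ≠ 0 := fun h => hs₀ ((hker s₀).mp h)
  set φ := -(τ r₀ / τ s₀) with hφ
  have hφ' : τ s₀ * φ = -τ r₀ := by rw [hφ]; field_simp
  induction X using induction_left with
  | one =>
    exact ⟨1, 1, 1, by simp, rfl, by rw [map_one, _root_.map_one, sub_self]; exact Ideal.zero_mem _,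
      by simp⟩
  | add P Q hP hQ =>
    obtain ⟨s, r, c, hs, hsr, hm, hc⟩ := hP
    obtain ⟨s', r', c', hs', hsr', hm', hc'⟩ := hQ
    refine ⟨s * s', s' * r + s * r', c + c', by rw [_root_.map_mul]; exact mul_ne_zero hs hs', ?_,
      ?_, ?_⟩
    · rw [act_map_add_right, act_add, mul_comm s, act_mul, hsr, mul_comm s', act_mul h s s', hsr',
        act_mul, act_mul]
    · rw [map_add, map_add, add_sub_add_comm]
      exact Ideal.add_mem _ hm hm'
    · rw [map_add, _root_.map_mul, _root_.map_mul, _root_.map_mul, ← hc, ← hc']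
      ring
  | const_mul a P hP =>
    obtain ⟨s, r, c, hs, hsr, hm, hc⟩ := hP
    refine ⟨s, MvPolynomial.C a * r, τ (MvPolynomial.C a) * c, hs, ?_, ?_, ?_⟩
    · rw [← act_C h, ← act_mul, mul_comm s, act_mul, hsr, act_mul]
    · rw [map_const_mul, _root_.map_mul const, RingHom.comp_apply, ← mul_sub]
      exact Ideal.mul_mem_left _ _ hm
    · rw [_root_.map_mul, ← hc]
      ring
  | D_mul P hP =>
    obtain ⟨s, r, c, hs, hsr, hm, hc⟩ := hP
    -- Applying `∂` to `s · P = r · 1` gives `s · ∂P = r′ · 1 + r · ∂ - s′ · P`; the factor `s s₀`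
    -- clears `∂` and `P` into multiples of `1`. On the other side, `∂ c = c ∂ + c′` is congruent to
    -- `c′ - c φ`.
    refine ⟨s * s₀ * s, s * s₀ * r′ + s * r * r₀ - s₀ * s′ * r, c′ - c * φ, ?_, ?_, ?_, ?_⟩
    · rw [_root_.map_mul, _root_.map_mul]
      exact mul_ne_zero (mul_ne_zero hs hs₀') hs
    · have h1 := congrArg (fun Y => D F * Y) hsr
      simp only [D_mul_act, mul_one] at h1
      have h2 : act h s (D F * P) = act h r′ 1 + act h r (D F) - act h s′ P := by
        rw [← h1]
        abel
      have h3 : act h (s * s₀) (act h r (D F)) = act h (s * r * r₀) 1 := by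
        rw [← act_mul, show s * s₀ * r = s * r * s₀ by ring, act_mul, h₀, ← act_mul]
      have h4 : act h (s * s₀) (act h s′ P) = act h (s₀ * s′ * r) 1 := by
        rw [← act_mul, show s * s₀ * s′ = s₀ * s′ * s by ring, act_mul, hsr, ← act_mul]
      rw [act_mul, h2, map_sub, map_add, h3, h4, ← act_mul, act_sub, act_add]
    · rw [map_D_mul (map_C_comp_deriv hτ)]
      have : D K * map (τ.comp MvPolynomial.C) P - const (c′ - c * φ)
          = D K * (map (τ.comp MvPolynomial.C) P - const c) + const c * (D K + const φ) := by
        rw [mul_sub, D_mul_const, map_sub, _root_.map_mul, mul_add]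
        abel
      rw [this]
      exact Ideal.add_mem _ (Ideal.mul_mem_left _ _ hm)
        (Ideal.mul_mem_left _ _ (Ideal.mem_span_singleton_self _))
    · have h5 : τ s * c′ = τ r′ - τ s′ * c := by
        rw [hτ, hτ, ← hc, Derivation.leibniz, smul_eq_mul, smul_eq_mul]
        ring
      rw [map_sub, map_add]
      simp only [_root_.map_mul]
      linear_combination τ s * τ s₀ * h5 - τ s * τ s * c * hφ' + (τ s * τ r₀ - τ s₀ * τ s′) * hc

variable [CharZero F]

/-- Existence of the right factor `∂ + φ` of all `B - b`, where the element `B` of the centralizer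
has the value `b` on the spectral curve. -/
theorem exists_common_right_factor (h : IsCommutingTriple L A₁ A₂) (hL : L.order = 3) (hτ : ∀ g, τ g′ = (τ g)′)
    (hker : ∀ g, τ g = 0 ↔ g ∈ diffBC L A₁ A₂) {b : MvPolynomial (Fin 3) (constants F)}
    (hb : evalOps L A₁ A₂ b ∉ polysIn L) :
    ∃ φ : K, ∀ g : MvPolynomial (Fin 3) (constants F),
      map (τ.comp MvPolynomial.C) (evalOps L A₁ A₂ g)
        - const (τ (MvPolynomial.map (constants F).subtype g)) ∈ Ideal.span {D K + const φ} := by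
  obtain ⟨s₀, r₀, hs₀, h₀⟩ := exists_act_eq_act_one h hL hb (D F)
  refine ⟨-(τ r₀ / τ s₀), fun g => ?_⟩
  obtain ⟨s, r, c, hs, hsr, hm, hc⟩ := exists_congr_const h hτ hker hs₀ h₀ (evalOps L A₁ A₂ g)
  -- The operator `g(L, A₁, A₂)` is `g · 1`, so `s g - r` kills `1` and the function `c` must be the
  -- value of `g`.
  have h1 : act h (s * MvPolynomial.map (constants F).subtype g - r) 1 = 0 := by
    rw [act_sub, act_mul, act_map, one_mul, hsr, sub_self]
  have h2 := (hker _).mpr (mem_diffBC_of_act_eq_zero h hL one_ne_zero h1)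
  rw [map_sub, _root_.map_mul, ← hc, ← mul_sub] at h2
  rwa [sub_eq_zero.mp ((mul_eq_zero.mp h2).resolve_left hs)]

/-- Modulo the left ideal of `L - λ`, right multiplication by `L` becomes multiplication by the
constant `λ`. This carries identities of the action over to `Σ(Γ)[∂]`. -/
theorem map_act_lam_sub_mem (hτ : ∀ g, τ g′ = (τ g)′) (p : Polynomial F) (Y : DiffOp F) :
    map (τ.comp MvPolynomial.C) (act h (lam F p) Y)
      - const (τ (lam F p)) * map (τ.comp MvPolynomial.C) Y
      ∈ Ideal.span {map (τ.comp MvPolynomial.C) L - const (τ (MvPolynomial.X 0))} := by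
  have hι := map_C_comp_deriv hτ
  have hlam : ∀ P : DiffOp K, Commute (const (τ (MvPolynomial.X 0))) P :=
    const_commute (deriv_map_X_eq_zero hτ 0)
  induction p using Polynomial.induction_on' with
  | add p q hp hq =>
    rw [act_lam_add, map_add, map_add, map_add, map_add, add_mul, add_sub_add_comm]
    exact Ideal.add_mem _ hp hq
  | monomial j a =>
    set ℓ := map (τ.comp MvPolynomial.C) L
    set y := map (τ.comp MvPolynomial.C) Y
    have h1 : map (τ.comp MvPolynomial.C) (act h (lam F (Polynomial.monomial j a)) Y)
        - const (τ (lam F (Polynomial.monomial j a))) * y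
        = const (τ (MvPolynomial.C a)) * y * (ℓ ^ j - const (τ (MvPolynomial.X 0)) ^ j) := by
      rw [act_lam_monomial, map_const_mul, map_mul hι, map_pow hι, lam_monomial, _root_.map_mul,
        _root_.map_mul, _root_.map_pow, _root_.map_pow, mul_assoc, mul_assoc,
        ((hlam y).pow_left j).eq, RingHom.comp_apply, mul_sub, mul_sub]
    rw [h1]
    exact Ideal.mul_mem_left _ _
      -- Since `λ` is central, `ℓʲ - λʲ` is a geometric sum times `ℓ - λ`.
      (Ideal.mem_span_singleton'.mpr ⟨_, Commute.geom_sum₂_mul (hlam ℓ).symm j⟩)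

/-- The operators `1, B, B²` are linearly independent over `Σ(Γ)` modulo the left ideal of
`L - λ`. -/
theorem eq_zero_of_sum_pow_mem_span (h : IsCommutingTriple L A₁ A₂) (hL : L.order = 3) (hτ : ∀ g, τ g′ = (τ g)′)
    (hker : ∀ g, τ g = 0 ↔ g ∈ diffBC L A₁ A₂) {B : DiffOp F} (hB : B ∈ centralizerOp L)
    (hB' : B ∉ polysIn L) {v : Fin 3 → K}
    (hv : ∑ k, const (v k) * map (τ.comp MvPolynomial.C) B ^ (k : ℕ)
      ∈ Ideal.span {map (τ.comp MvPolynomial.C) L - const (τ (MvPolynomial.X 0))})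
    (hdeg : (map (τ.comp MvPolynomial.C) L - const (τ (MvPolynomial.X 0))).degree = (3 : ℕ)) :
    v = 0 := by
  have hι := map_C_comp_deriv hτ
  set J := Ideal.span {map (τ.comp MvPolynomial.C) L - const (τ (MvPolynomial.X 0))}
  obtain ⟨M, hdet, hM⟩ := exists_matrix_pow h hL hB hB'
  set f : Polynomial F →+* K := τ.comp (lam F)
  have hdet' : (M.map f).det ≠ 0 := by
    rw [← RingHom.mapMatrix_apply, ← RingHom.map_det]
    exact fun h0 => lam_notMem_diffBC h hL hdet ((hker _).mp h0)
  have hk : ∀ k : Fin 3, map (τ.comp MvPolynomial.C) B ^ (k : ℕ)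
      - ∑ i, const (f (M i k)) * D K ^ (i : ℕ) ∈ J := by
    intro k
    rw [← map_pow hι, hM k, map_sum, ← Finset.sum_sub_distrib]
    refine Ideal.sum_mem _ fun i _ => ?_
    have := map_act_lam_sub_mem h hτ (M i k) (D F ^ (i : ℕ))
    rwa [map_pow hι, map_D] at this
  -- Rewriting `1, B, B²` through `1, ∂, ∂²` leaves an element of the ideal of order at most two; as
  -- the generator has order three, it is zero.
  have h1 : ∑ i, const ((M.map f).mulVec v i) * D K ^ (i : ℕ) ∈ J := by
    have h2 : ∑ k, const (v k) * (map (τ.comp MvPolynomial.C) B ^ (k : ℕ)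
        - ∑ i, const (f (M i k)) * D K ^ (i : ℕ)) ∈ J :=
      Ideal.sum_mem _ fun k _ => Ideal.mul_mem_left _ _ (hk k)
    have h3 := Ideal.sub_mem _ hv h2
    simp only [mul_sub, Finset.sum_sub_distrib, sub_sub_cancel] at h3
    have h4 : ∑ i, const ((M.map f).mulVec v i) * D K ^ (i : ℕ)
        = ∑ k, const (v k) * ∑ i, const (f (M i k)) * D K ^ (i : ℕ) := by
      simp only [Matrix.mulVec, dotProduct, map_sum, Finset.sum_mul, Finset.mul_sum]
      rw [Finset.sum_comm]
      refine Finset.sum_congr rfl fun k _ => Finset.sum_congr rfl fun i _ => ?_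
      rw [Matrix.map_apply, mul_comm (f _), _root_.map_mul, mul_assoc]
    rwa [h4]
  have hcoeff : ∀ j : ℕ, (∑ i, const ((M.map f).mulVec v i) * D K ^ (i : ℕ)).coeff j
      = ∑ i : Fin 3, if j = i then (M.map f).mulVec v i else 0 := by
    intro j
    rw [coeff_sum]
    exact Finset.sum_congr rfl fun i _ => by rw [coeff_const_mul, coeff_D_pow]; simp
  have h5 := eq_zero_of_mem_span_of_degree_lt h1 (by
    rw [hdeg, degree_lt_iff]
    intro j hj
    rw [hcoeff]
    exact Finset.sum_eq_zero fun i _ => if_neg (by omega))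
  refine Matrix.eq_zero_of_mulVec_eq_zero hdet' ?_
  funext i
  have h6 := hcoeff i
  rw [h5, coeff_zero] at h6
  simpa [Fin.val_inj] using h6.symm

end SpectralField

/-! ### The first differential subresultant. -/

section Subresultant

/-- The row number `k` of the matrix `S₁` of operators of orders `n` and `m`. -/
def rowOp {R : Type*} [CommRing R] [Differential R] (P Q : DiffOp R) (n m k : ℕ) : DiffOp R :=
  if k < m - 1 then D R ^ (m - 2 - k) * P else D R ^ (n + m - 3 - k) * Q

/-- The matrix `S₁ᶜ` of operators of orders `n` and `m`. -/
def rowMatrix {R : Type*} [CommRing R] [Differential R] (P Q : DiffOp R) (n m c : ℕ) :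
    Matrix (Fin (n + m - 2)) (Fin (n + m - 2)) R :=
  Matrix.of fun k j => (rowOp P Q n m k).coeff
    (if (j : ℕ) + 1 = n + m - 2 then c else n + m - 2 - j)

theorem map_rowOp {R S : Type*} [CommRing R] [Differential R] [CommRing S] [Differential S]
    {f : R →+* S} (hf : ∀ a, f a′ = (f a)′) (P Q : DiffOp R) (n m k : ℕ) :
    map f (rowOp P Q n m k) = rowOp (map f P) (map f Q) n m k := by
  unfold rowOp
  split_ifs <;> rw [map_mul hf, map_pow hf, map_D]

/-- The size of the matrix depends on the orders, so these are fixed as `n` and `m` before the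
coefficients change ring. -/
theorem map_det_subresMatrix {R S : Type*} [CommRing R] [Differential R] [CommRing S]
    [Differential S] {f : R →+* S} (hf : ∀ a, f a′ = (f a)′) (P Q : DiffOp R) {n m : ℕ}
    (hn : P.order = n) (hm : Q.order = m) (c : ℕ) :
    f (subresMatrix P Q c).det = (rowMatrix (map f P) (map f Q) n m c).det := by
  subst hn hm
  rw [RingHom.map_det]
  congr 1
  ext k j
  rw [RingHom.mapMatrix_apply, Matrix.map_apply, subresMatrix, rowMatrix, Matrix.of_apply,
    Matrix.of_apply, ← map_rowOp hf, coeff_map]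
  rfl

theorem subres_eq {R : Type*} [CommRing R] [Differential R] (P Q : DiffOp R) :
    subres P Q = const (subresMatrix P Q 0).det + const (subresMatrix P Q 1).det * D R := rfl

theorem coeff_const_add_const_mul_D {R : Type*} [CommRing R] [Differential R] (a b : R) (i : ℕ) :
    (const a + const b * D R).coeff i = if i = 0 then a else if i = 1 then b else 0 := by
  rw [coeff_add, coeff_const, coeff_const_mul, ← pow_one (D R), coeff_D_pow]
  rcases i with _ | _ | i <;> simp

theorem coeff_subres_one {R : Type*} [CommRing R] [Differential R] (P Q : DiffOp R) :
    (subres P Q).coeff 1 = (subresMatrix P Q 1).det := by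
  rw [subres_eq, coeff_const_add_const_mul_D]
  simp

variable {K : Type*} [Field K] [Differential K] {P Q : DiffOp K} {n m : ℕ}

theorem rowOp_mem_span (k : ℕ) : rowOp P Q n m k ∈ Ideal.span {P, Q} := by
  unfold rowOp
  split_ifs
  · exact Ideal.mul_mem_left _ _ (Ideal.subset_span (by simp))
  · exact Ideal.mul_mem_left _ _ (Ideal.subset_span (by simp))

theorem degree_rowOp_le (hP : P.degree ≤ n) (hQ : Q.degree ≤ m) (hm : 1 ≤ m) {k : ℕ}
    (hk : k < n + m - 2) : (rowOp P Q n m k).degree ≤ (n + m - 2 : ℕ) := by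
  unfold rowOp
  split_ifs with h
  · exact (degree_mul_le_of_le (degree_D_pow _).le hP).trans (by exact_mod_cast (by omega))
  · exact (degree_mul_le_of_le (degree_D_pow _).le hQ).trans (by exact_mod_cast (by omega))

/-- The first subresultant lies in the left ideal generated by the two operators. -/
theorem const_add_const_mul_D_mem_span (hP : P.degree ≤ n) (hQ : Q.degree ≤ m) (hm : 1 ≤ m)
    (hnm : 3 ≤ n + m) : const (rowMatrix P Q n m 0).det + const (rowMatrix P Q n m 1).det * D K
      ∈ Ideal.span {P, Q} := by
  set N := n + m - 2 with hN
  set M := rowMatrix P Q n m 0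
  set last : Fin N := ⟨N - 1, by omega⟩ with hlast
  set col : ℕ → Fin N → K := fun i k => (rowOp P Q n m k).coeff i with hcol
  -- The determinant as a linear functional of its last column. Its cofactors are the multipliers of
  -- the rows, and the combination has `i`-th coefficient `ψ (col i)`.
  set ψ : (Fin N → K) →ₗ[K] K := (LinearMap.proj last).comp (Matrix.cramer M)
  have hψ : ∀ b, ψ b = (M.updateCol last b).det := fun b => Matrix.cramer_apply M b last
  have hupd : ∀ c : ℕ, M.updateCol last (col c) = rowMatrix P Q n m c := by
    intro c
    ext k j
    rw [Matrix.updateCol_apply]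
    split_ifs with hj
    · simp only [rowMatrix, Matrix.of_apply, hcol]
      rw [if_pos]
      rw [hj, hlast]
      change N - 1 + 1 = N
      omega
    · have hj' : (j : ℕ) + 1 ≠ n + m - 2 := fun h => hj (Fin.ext (by
        rw [hlast]
        change (j : ℕ) = N - 1
        omega))
      simp only [M, rowMatrix, Matrix.of_apply, if_neg hj']
  have hzero : ∀ i, 2 ≤ i → ψ (col i) = 0 := by
    intro i hi
    by_cases hiN : i ≤ N
    · rw [hψ]
      -- For `2 ≤ i ≤ N` the column of `∂ⁱ` already stands at position `N - i`, so the determinant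
      -- has a repeated column.
      have hne : last ≠ ⟨N - i, by omega⟩ := by
        rw [hlast, Ne, Fin.mk.injEq]
        omega
      refine Matrix.det_zero_of_column_eq hne fun k => ?_
      rw [Matrix.updateCol_self, Matrix.updateCol_ne hne.symm]
      simp only [M, rowMatrix, Matrix.of_apply, hcol]
      rw [if_neg (by omega)]
      congr 1
      omega
    · have : col i = 0 := by
        funext k
        exact coeff_eq_zero_of_degree_lt ((degree_rowOp_le hP hQ hm k.2).trans_lt
          (by exact_mod_cast (by omega)))
      rw [this, map_zero]
  have hsum : ∑ k : Fin N, const (ψ (Pi.single k 1)) * rowOp P Q n m k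
      = const (rowMatrix P Q n m 0).det + const (rowMatrix P Q n m 1).det * D K := by
    ext i
    rw [coeff_sum, coeff_const_add_const_mul_D]
    have h1 : ∑ k : Fin N, (const (ψ (Pi.single k 1)) * rowOp P Q n m k).coeff i = ψ (col i) := by
      rw [LinearMap.pi_apply_eq_sum_univ ψ (col i)]
      refine Finset.sum_congr rfl fun k _ => ?_
      rw [coeff_const_mul, smul_eq_mul, mul_comm]
      congr 2
      funext j
      simp [Pi.single_apply, eq_comm]
    rw [h1]
    split_ifs with h0 h0'
    · rw [hψ, h0, hupd]
    · rw [hψ, h0', hupd]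
    · exact hzero i (by omega)
  rw [← hsum]
  exact Ideal.sum_mem _ fun k _ => Ideal.mul_mem_left _ _ (rowOp_mem_span k)

/-- If the subresultant degenerates, then a nonzero operator of degree at most one multiplies `Q`
into the left ideal of `P`. -/
theorem exists_mul_mem_span_of_det_eq_zero (hP : P.degree = (3 : ℕ)) (hQ : Q.degree = m)
    (hm : 1 ≤ m) {φ : K} (hPφ : P ∈ Ideal.span {D K + const φ})
    (hQφ : Q ∈ Ideal.span {D K + const φ}) (hdet : (rowMatrix P Q 3 m 1).det = 0) :
    ∃ Y : DiffOp K, Y ≠ 0 ∧ Y.degree ≤ 1 ∧ Y * Q ∈ Ideal.span {P} := by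
  have hP0 : P ≠ 0 := by
    intro h
    rw [h, degree_zero] at hP
    exact WithBot.bot_ne_coe hP
  obtain ⟨v, hv0, hv⟩ := Matrix.exists_vecMul_eq_zero_iff.mpr hdet
  set w : ℕ → K := fun k => if h : k < 3 + m - 2 then v ⟨k, h⟩ else 0 with hw
  have hwv : ∀ k : Fin (3 + m - 2), w k = v k := fun k => by simp [hw]
  set T := ∑ k : Fin (3 + m - 2), const (v k) * rowOp P Q 3 m k with hT
  have hTcoeff : ∀ i, T.coeff i = ∑ k, v k * (rowOp P Q 3 m k).coeff i := by
    intro i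
    rw [hT, coeff_sum]
    exact Finset.sum_congr rfl fun k _ => coeff_const_mul _ _ _
  -- The vanishing determinant uses the columns of all positive powers of `∂`, so only the
  -- coefficient of `1` can survive in `T`.
  have hTdeg : T.degree ≤ 0 := by
    rw [degree_le_iff]
    intro i hi
    have hi : 0 < i := by exact_mod_cast hi
    rw [hTcoeff]
    by_cases hiN : i ≤ 3 + m - 2
    · have := congrFun hv ⟨3 + m - 2 - i, by omega⟩
      refine Eq.trans ?_ this
      refine Finset.sum_congr rfl fun k _ => ?_
      simp only [rowMatrix, Matrix.of_apply]
      congr 2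
      split_ifs <;> omega
    · refine Finset.sum_eq_zero fun k _ => ?_
      rw [coeff_eq_zero_of_degree_lt ((degree_rowOp_le hP.le hQ.le hm k.2).trans_lt
        (by exact_mod_cast (by omega))), mul_zero]
  have hTφ : T ∈ Ideal.span {D K + const φ} := by
    refine Ideal.sum_mem _ fun k _ => Ideal.mul_mem_left _ _ ?_
    unfold rowOp
    split_ifs
    · exact Ideal.mul_mem_left _ _ hPφ
    · exact Ideal.mul_mem_left _ _ hQφ
  -- A function that is a left multiple of `∂ + φ` vanishes, by orders.
  have hT0 : T = 0 := by
    rw [eq_const_of_degree_le hTdeg] at hTφ ⊢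
    rw [eq_zero_of_const_mem_span hTφ, map_zero]
  set X : DiffOp K := ∑ k ∈ Finset.range (m - 1), const (w k) * D K ^ (m - 2 - k) with hX
  -- As `P` has order three, only the last two rows, `∂ Q` and `Q`, come from `Q`.
  set Y : DiffOp K := const (w (m - 1)) * D K + const (w m) with hY
  have hXY : X * P + Y * Q = 0 := by
    rw [← hT0, hT]
    have : ∑ k : Fin (3 + m - 2), const (v k) * rowOp P Q 3 m k
        = ∑ k ∈ Finset.range (3 + m - 2), const (w k) * rowOp P Q 3 m k := by
      rw [Finset.sum_range]
      exact Finset.sum_congr rfl fun k _ => by rw [hwv]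
    rw [this, show 3 + m - 2 = m - 1 + 1 + 1 by omega, Finset.sum_range_succ,
      Finset.sum_range_succ, show m - 1 + 1 = m by omega, add_assoc, hX, Finset.sum_mul, hY,
      add_mul]
    have e1 : rowOp P Q 3 m (m - 1) = D K * Q := by
      rw [rowOp, if_neg (lt_irrefl _), show 3 + m - 3 - (m - 1) = 1 by omega, pow_one]
    have e2 : rowOp P Q 3 m m = Q := by
      rw [rowOp, if_neg (by omega), show 3 + m - 3 - m = 0 by omega, pow_zero, one_mul]
    rw [e1, e2, mul_assoc]
    congr 1
    refine Finset.sum_congr rfl fun k hk => ?_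
    rw [rowOp, if_pos (Finset.mem_range.mp hk), mul_assoc]
  -- If `Y = 0` then `X * P = 0`, hence `X = 0`, and all entries of the kernel vector vanish.
  refine ⟨Y, fun hY0 => hv0 ?_, ?_, ?_⟩
  · rw [hY0, zero_mul, add_zero] at hXY
    have hX0 := (mul_eq_zero.mp hXY).resolve_right hP0
    have hYc : ∀ i, (const (w m) + const (w (m - 1)) * D K).coeff i = 0 := by
      intro i
      rw [add_comm, ← hY, hY0, coeff_zero]
    have hwm : w m = 0 := by simpa [coeff_const_add_const_mul_D] using hYc 0
    have hwm1 : w (m - 1) = 0 := by simpa [coeff_const_add_const_mul_D] using hYc 1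
    have hwk : ∀ k < m - 1, w k = 0 := by
      intro k hk
      have h1 : X.coeff (m - 2 - k) = 0 := by rw [hX0, coeff_zero]
      rw [hX, coeff_sum, Finset.sum_eq_single k] at h1
      · rwa [coeff_const_mul, coeff_D_pow, if_pos rfl, mul_one] at h1
      · intro j hj hjk
        rw [coeff_const_mul, coeff_D_pow, if_neg, mul_zero]
        rw [Finset.mem_range] at hj
        omega
      · exact fun h => absurd (Finset.mem_range.mpr hk) h
    funext k
    rw [← hwv, Pi.zero_apply]
    rcases (show (k : ℕ) < m - 1 ∨ (k : ℕ) = m - 1 ∨ (k : ℕ) = m by omega) with hk | hk | hk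
    · exact hwk k hk
    · rw [hk, hwm1]
    · rw [hk, hwm]
  · refine (degree_add_le _ _).trans (max_le ?_ ((degree_const_le _).trans (by norm_num)))
    refine (degree_const_mul_le _ _).trans ?_
    rw [← pow_one (D K)]
    exact (degree_D_pow 1).le
  · rw [eq_neg_of_add_eq_zero_right hXY, ← neg_mul]
    exact Ideal.mul_mem_left _ _ (Ideal.mem_span_singleton_self P)

/-- Modulo an operator of degree at most one, every operator is congruent to a function. -/
theorem exists_sq_sub_mem_span {Y : DiffOp K} (hY0 : Y ≠ 0)
    (hY : Y.degree ≤ 1) (hYQ : Y * Q ∈ Ideal.span {P}) :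
    ∃ r : K, Q * Q - const r * Q ∈ Ideal.span {P} := by
  obtain ⟨N, R, h, hR⟩ := exists_eq_mul_add hY0 Q
  have hR' : R.degree ≤ 0 := by
    have hY1 : Y.order ≤ 1 := order_le_of_degree_le hY
    rw [degree_le_iff]
    intro i hi
    have hi : 0 < i := by exact_mod_cast hi
    exact degree_lt_iff.mp hR i (by omega)
  refine ⟨R.coeff 0, ?_⟩
  rw [← eq_const_of_degree_le hR']
  -- From `Q = N Y + R` with `R` a function, multiplied by `Q` on the right.
  have : Q * Q - R * Q = N * (Y * Q) := by
    rw [← mul_assoc, ← sub_mul]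
    congr 1
    exact sub_eq_of_eq_add h
  rw [this]
  exact Ideal.mul_mem_left _ _ hYQ

theorem isGCRD_of_mem_span {S : Set (DiffOp K)} {G : DiffOp K} (h : ∀ P ∈ S, P ∈ Ideal.span {G})
    (hG : G ∈ Ideal.span S) : IsGCRD S G := by
  refine ⟨fun P hP => rightDvd_iff.mpr (h P hP), fun H hH => rightDvd_iff.mpr ?_⟩
  exact Ideal.span_le.mpr (fun P hP => rightDvd_iff.mp (hH P hP)) hG

/-- If `P` and `Q` have the common right factor `∂ + φ`, and `Q` satisfies no quadratic equation
modulo the left ideal of `P`, then the first subresultant is a nonzero multiple of `∂ + φ`. -/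
theorem subresultant_eq (hP : P.degree = (3 : ℕ)) (hQ : Q.degree = m) (hm : 1 ≤ m)
    {φ : K} (hPφ : P ∈ Ideal.span {D K + const φ})
    (hQφ : Q ∈ Ideal.span {D K + const φ})
    (hquad : ∀ r : K, Q * Q - const r * Q ∉ Ideal.span {P}) :
    (rowMatrix P Q 3 m 1).det ≠ 0 ∧
      const (rowMatrix P Q 3 m 0).det + const (rowMatrix P Q 3 m 1).det * D K
        = const (rowMatrix P Q 3 m 1).det * (D K + const φ) ∧
      D K + const φ ∈ Ideal.span {P, Q} := by
  have hdet : (rowMatrix P Q 3 m 1).det ≠ 0 := by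
    intro h
    obtain ⟨Y, hY0, hY, hYQ⟩ := exists_mul_mem_span_of_det_eq_zero hP hQ hm hPφ hQφ h
    obtain ⟨r, hr⟩ := exists_sq_sub_mem_span hY0 hY hYQ
    exact hquad r hr
  have hmem := const_add_const_mul_D_mem_span hP.le hQ.le hm (by omega : 3 ≤ 3 + m)
  have hle : Ideal.span {P, Q} ≤ Ideal.span {D K + const φ} := by
    rw [Ideal.span_le]
    rintro x (rfl | rfl)
    exacts [hPφ, hQφ]
  have heq : const (rowMatrix P Q 3 m 0).det + const (rowMatrix P Q 3 m 1).det * D K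
      = const (rowMatrix P Q 3 m 1).det * (D K + const φ) := by
    have h1 := Ideal.sub_mem _ (hle hmem) (Ideal.mul_mem_left _
      (const (rowMatrix P Q 3 m 1).det) (Ideal.mem_span_singleton_self (D K + const φ)))
    have h2 : const (rowMatrix P Q 3 m 0).det + const (rowMatrix P Q 3 m 1).det * D K
        - const (rowMatrix P Q 3 m 1).det * (D K + const φ)
        = const ((rowMatrix P Q 3 m 0).det - (rowMatrix P Q 3 m 1).det * φ) := by
      rw [map_sub, _root_.map_mul, mul_add]
      abel
    rw [h2] at h1
    rw [← sub_eq_zero, h2, eq_zero_of_const_mem_span h1, map_zero]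
  refine ⟨hdet, heq, ?_⟩
  have h3 : D K + const φ = const (rowMatrix P Q 3 m 1).det⁻¹
      * (const (rowMatrix P Q 3 m 0).det + const (rowMatrix P Q 3 m 1).det * D K) := by
    rw [heq, ← mul_assoc, ← _root_.map_mul, inv_mul_cancel₀ hdet, _root_.map_one, one_mul]
  rw [h3]
  exact Ideal.mul_mem_left _ _ hmem

end Subresultant

/-! ### Specialization to `L - λ` and `B - b`, and the conclusion. -/

section Main

theorem degree_sub_const {R : Type*} [CommRing R] [Differential R] {P : DiffOp R} {n : ℕ}
    (hP : P.degree = n) (hn : 1 ≤ n) (a : R) : (P - const a).degree = n := by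
  refine degree_eq_of_coeff ((degree_sub_le _ _).trans (max_le hP.le
    ((degree_const_le a).trans (by exact_mod_cast Nat.zero_le n)))) ?_
  rw [coeff_sub, coeff_const, if_neg (by omega), sub_zero, ← order_eq_of_degree_eq hP]
  refine coeff_order_ne_zero fun h => ?_
  rw [h, degree_zero] at hP
  exact WithBot.bot_ne_coe hP

variable {F : Type*} [Field F] [Differential F] {L A₁ A₂ : DiffOp F}

theorem degree_map {S : Type*} [CommRing S] [Nontrivial S] [Differential S] (f : F →+* S)
    (P : DiffOp F) : (map f P).degree = P.degree := Polynomial.degree_map (R := F) P f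

theorem map_shiftOp {K : Type*} [CommRing K] [Differential K] (τ : MvPolynomial (Fin 3) F →+* K)
    (P : DiffOp F) (g : MvPolynomial (Fin 3) F) :
    map τ (shiftOp P g) = map (τ.comp MvPolynomial.C) P - const (τ g) := by
  rw [shiftOp, map_sub, map_map, map_const]

theorem order_shiftOp {P : DiffOp F} (hP : 1 ≤ P.order) (g : MvPolynomial (Fin 3) F) :
    (shiftOp P g).order = P.order := by
  refine order_eq_of_degree_eq (degree_sub_const ?_ hP g)
  rw [degree_map, degree_eq_order]
  rintro rfl
  rw [order_zero] at hP
  omega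

theorem degree_map_shiftOp {K : Type*} [CommRing K] [Nontrivial K] [Differential K]
    (τ : MvPolynomial (Fin 3) F →+* K) {P : DiffOp F} (hP : 1 ≤ P.order)
    (g : MvPolynomial (Fin 3) F) : (map τ (shiftOp P g)).degree = P.order := by
  rw [map_shiftOp]
  refine degree_sub_const ?_ hP _
  rw [degree_map, degree_eq_order]
  rintro rfl
  rw [order_zero] at hP
  omega

variable [CharZero F]

/-- An element of order zero in the centralizer is comparable with `1`, so it is a constant. -/
theorem one_le_order_of_notMem_polysIn (hL : L.order = 3) {B : DiffOp F}
    (hB : B ∈ centralizerOp L) (hB' : B ∉ polysIn L) : 1 ≤ B.order := by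
  by_contra h
  obtain ⟨c, hc⟩ := exists_degree_sub_smul_lt hL (Subalgebra.one_mem _) hB one_ne_zero
    ((degree_le_order B).trans (by exact_mod_cast (by omega)))
  rw [show (1 : DiffOp F).order = 0 from Polynomial.natDegree_one (R := F)] at hc
  have h0 : B - c • 1 = 0 := by
    ext i
    exact degree_lt_iff.mp hc i (Nat.zero_le i)
  exact hB' (sub_eq_zero.mp h0 ▸ Subalgebra.smul_mem _ (Subalgebra.one_mem _) c)

theorem IsCentralizerBasis.mem (h : IsCentralizerBasis L A₁ A₂) (i : Fin 3) :
    ![1, A₁, A₂] i ∈ centralizerOp L := by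
  have h2 : ![1, A₁, A₂] i ∈ (centralizerOp L : Set (DiffOp F)) := by
    rw [← h.2]
    exact Submodule.subset_span ⟨i, rfl⟩
  exact h2

theorem IsCentralizerBasis.notMem (h : IsCentralizerBasis L A₁ A₂) {i : Fin 3} (hi : i ≠ 0) :
    ![1, A₁, A₂] i ∉ polysIn L := by
  intro hmem
  have h1 := Fintype.linearIndependent_iff.mp h.1
    -- If `A = Aᵢ` were in `C[L]`, then `A · 1 - 1 · A = 0` would be a nontrivial relation.
    (Pi.single 0 ⟨![1, A₁, A₂] i, hmem⟩ - Pi.single i 1) (by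
      simp only [Pi.sub_apply, sub_smul, Finset.sum_sub_distrib]
      rw [Finset.sum_eq_single 0, Finset.sum_eq_single i, Pi.single_eq_same, Pi.single_eq_same,
        one_smul]
      · change ![1, A₁, A₂] i * 1 - _ = 0
        rw [mul_one, sub_self]
      · exact fun j _ hj => by rw [Pi.single_eq_of_ne hj, zero_smul]
      · simp
      · exact fun j _ hj => by rw [Pi.single_eq_of_ne hj, zero_smul]
      · simp) i
  rw [Pi.sub_apply, Pi.single_eq_of_ne hi, Pi.single_eq_same, zero_sub, neg_eq_zero] at h1
  exact one_ne_zero h1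

variable {K : Type*} [Field K] [Differential K] {τ : MvPolynomial (Fin 3) F →+* K}

/-- The first subresultant of `L - λ` and `B - b`, where the element `B` of the centralizer has the
value `b` on the spectral curve. -/
theorem subres_shiftOp (h : IsCommutingTriple L A₁ A₂) (hL : L.order = 3)
    (hτ : ∀ g, τ g′ = (τ g)′) (hker : ∀ g, τ g = 0 ↔ g ∈ diffBC L A₁ A₂)
    {b : MvPolynomial (Fin 3) (constants F)} (hb : evalOps L A₁ A₂ b ∉ polysIn L) {φ : K}
    (hφ : ∀ g : MvPolynomial (Fin 3) (constants F),
      map τ (shiftOp (evalOps L A₁ A₂ g) (MvPolynomial.map (constants F).subtype g))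
        ∈ Ideal.span {D K + const φ}) :
    D K + const φ ∈ Ideal.span {map τ (shiftOp L (MvPolynomial.X 0)),
        map τ (shiftOp (evalOps L A₁ A₂ b) (MvPolynomial.map (constants F).subtype b))} ∧
      τ ((subres (shiftOp L (MvPolynomial.X 0)) (shiftOp (evalOps L A₁ A₂ b)
        (MvPolynomial.map (constants F).subtype b))).coeff 1) ≠ 0 ∧
      map τ (subres (shiftOp L (MvPolynomial.X 0)) (shiftOp (evalOps L A₁ A₂ b)
          (MvPolynomial.map (constants F).subtype b)))
        = const (τ ((subres (shiftOp L (MvPolynomial.X 0)) (shiftOp (evalOps L A₁ A₂ b)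
          (MvPolynomial.map (constants F).subtype b))).coeff 1)) * (D K + const φ) := by
  set B := evalOps L A₁ A₂ b with hB
  set μ := MvPolynomial.map (constants F).subtype b with hμ
  have hBZ : B ∈ centralizerOp L := evalOps_mem_centralizerOp h b
  have hord : 1 ≤ B.order := one_le_order_of_notMem_polysIn hL hBZ hb
  have hord3 : 1 ≤ L.order := by omega
  have hP : (map τ (shiftOp L (MvPolynomial.X 0))).degree = (3 : ℕ) := by
    rw [degree_map_shiftOp τ hord3, hL]
  have hPφ : map τ (shiftOp L (MvPolynomial.X 0)) ∈ Ideal.span {D K + const φ} := by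
    have := hφ (MvPolynomial.X 0)
    rwa [evalOps_X h, MvPolynomial.map_X] at this
  have hquad : ∀ r : K, map τ (shiftOp B μ) * map τ (shiftOp B μ) - const r * map τ (shiftOp B μ)
      ∉ Ideal.span {map τ (shiftOp L (MvPolynomial.X 0))} := by
    intro r hr
    have hcomm : Commute (const (τ μ)) (map (τ.comp MvPolynomial.C) B) :=
      const_commute (deriv_map_constants_eq_zero hτ b) _
    -- The coefficients of `1, B, B²` in `(B - μ)² - r (B - μ)`; the last one is `1`.
    have h0 : (![τ μ * τ μ + r * τ μ, -(τ μ + τ μ + r), 1] : Fin 3 → K) = 0 := by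
      rw [map_shiftOp τ L] at hr hP
      refine eq_zero_of_sum_pow_mem_span h hL hτ hker hBZ hb ?_ hP
      convert hr using 1
      rw [map_shiftOp]
      simp only [Fin.sum_univ_three, Matrix.cons_val_zero, Matrix.cons_val_one, Matrix.cons_val,
        Fin.val_zero, Fin.val_one, Fin.val_two, pow_zero, pow_one, mul_one, map_add, map_neg,
        _root_.map_mul, _root_.map_one, one_mul, sub_mul, mul_sub, pow_two, ← hcomm.eq]
      noncomm_ring
    exact one_ne_zero (congrFun h0 2)
  obtain ⟨h1, h2, h3⟩ := subresultant_eq hP (degree_map_shiftOp τ hord μ) hord hPφ (hφ b) hquad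
  have hdet := map_det_subresMatrix hτ (shiftOp L (MvPolynomial.X 0)) (shiftOp B μ)
    ((order_shiftOp hord3 _).trans hL) (order_shiftOp hord μ)
  refine ⟨h3, ?_, ?_⟩
  · rwa [coeff_subres_one, hdet]
  · rw [coeff_subres_one, hdet, ← h2, subres_eq, map_add, map_const, map_mul hτ, map_const, map_D,
      hdet, hdet]

end Main

end DiffOp

theorem toSpectral_deriv {F : Type*} [Field F] [Differential F] (L A₁ A₂ : DiffOp F)
    (g : MvPolynomial (Fin 3) F) : toSpectral L A₁ A₂ g′ = (toSpectral L A₁ A₂ g)′ := by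
  rw [toSpectral, RingHom.comp_apply, RingHom.comp_apply, ← deriv_mk_diffSpan]
  exact (DifferentialAlgebra.deriv_algebraMap _).symm

theorem toSpectral_eq_zero_iff {F : Type*} [Field F] [Differential F] {L A₁ A₂ : DiffOp F}
    (g : MvPolynomial (Fin 3) F) : toSpectral L A₁ A₂ g = 0 ↔ g ∈ diffBC L A₁ A₂ := by
  rw [toSpectral, RingHom.comp_apply, ← Ideal.Quotient.eq_zero_iff_mem]
  exact map_eq_zero_iff _ (IsFractionRing.injective _ _)

open DiffOp in
theorem mainTheorem3 {F : Type*} [Field F] [CharZero F] [Differential F]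
    [IsAlgClosed (constants F)] (L : DiffOp F) (hord : L.order = 3)
    (hconst : ¬ L.HasConstantCoeffs) (hZ : HasNontrivialCentralizer L) :
    (∃ A₁ A₂ : DiffOp F, IsCentralizerBasis L A₁ A₂) ∧
    ∀ A₁ A₂ : DiffOp F, IsCentralizerBasis L A₁ A₂ →
      (diffBC L A₁ A₂).IsPrime ∧
      ∃ φ : SpectralField L A₁ A₂,
        -- `∂ + φ` is a right factor of `L - λ`
        DiffOp.RightDvd (DiffOp.D _ + DiffOp.const φ)
          (shiftOpΓ L A₁ A₂ L (MvPolynomial.X 0)) ∧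
        -- `∂ + φ = gcrd(L - λ, A₁ - μ₁, A₂ - μ₂)`
        DiffOp.IsGCRD
          {shiftOpΓ L A₁ A₂ L (MvPolynomial.X 0), shiftOpΓ L A₁ A₂ A₁ (MvPolynomial.X 1),
            shiftOpΓ L A₁ A₂ A₂ (MvPolynomial.X 2)}
          (DiffOp.D _ + DiffOp.const φ) ∧
        -- the same factor is obtained from any basis `{1, B₁, B₂}` of the centralizer, where
        -- `B₁, B₂` have the values `g₁, g₂` on the spectral curve
        (∀ B₁ B₂ : DiffOp F, IsCentralizerBasis L B₁ B₂ →
          ∀ g₁ g₂ : MvPolynomial (Fin 3) (constants F),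
            evalOps L A₁ A₂ g₁ = B₁ → evalOps L A₁ A₂ g₂ = B₂ →
            DiffOp.IsGCRD
              {shiftOpΓ L A₁ A₂ L (MvPolynomial.X 0),
                shiftOpΓ L A₁ A₂ B₁ (MvPolynomial.map (constants F).subtype g₁),
                shiftOpΓ L A₁ A₂ B₂ (MvPolynomial.map (constants F).subtype g₂)}
              (DiffOp.D _ + DiffOp.const φ)) ∧
        -- for `i = 1, 2`: `∂ + φ = gcrd(L - λ, Aᵢ - μᵢ)`, and `φ = φᵢ₀ / φᵢ₁`, where
        -- `φᵢ₀ + φᵢ₁ ∂` is the first differential subresultant of `L - λ` and `Aᵢ - μᵢ`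
        ∀ (A : DiffOp F) (μ : MvPolynomial (Fin 3) F),
          (A = A₁ ∧ μ = MvPolynomial.X 1) ∨ (A = A₂ ∧ μ = MvPolynomial.X 2) →
          DiffOp.IsGCRD
            {shiftOpΓ L A₁ A₂ L (MvPolynomial.X 0), shiftOpΓ L A₁ A₂ A μ}
            (DiffOp.D _ + DiffOp.const φ) ∧
          toSpectral L A₁ A₂ ((DiffOp.subres (shiftOp L (MvPolynomial.X 0))
            (shiftOp A μ)).coeff 1) ≠ 0 ∧
          DiffOp.map (toSpectral L A₁ A₂)
              (DiffOp.subres (shiftOp L (MvPolynomial.X 0)) (shiftOp A μ)) =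
            DiffOp.const (toSpectral L A₁ A₂ ((DiffOp.subres (shiftOp L (MvPolynomial.X 0))
              (shiftOp A μ)).coeff 1)) * (DiffOp.D _ + DiffOp.const φ) := by

  refine ⟨exists_isCentralizerBasis hord hZ.1, fun A₁ A₂ hA => ?_⟩
  have h : IsCommutingTriple L A₁ A₂ :=
    ⟨IsCentralizerBasis.mem hA 1, IsCentralizerBasis.mem hA 2,
      commute_of_mem_centralizerOp hord hZ.1 (IsCentralizerBasis.mem hA 1)
        (IsCentralizerBasis.mem hA 2)⟩
  have hprime := isPrime_diffBC h hord
  refine ⟨hprime, ?_⟩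
  have hτ := toSpectral_deriv L A₁ A₂
  have hker := toSpectral_eq_zero_iff (L := L) (A₁ := A₁) (A₂ := A₂)
  have hX1 : evalOps L A₁ A₂ (MvPolynomial.X 1) = A₁ := evalOps_X h 1
  have hX2 : evalOps L A₁ A₂ (MvPolynomial.X 2) = A₂ := evalOps_X h 2
  have hn1 : A₁ ∉ polysIn L := IsCentralizerBasis.notMem hA (i := 1) (by decide)
  have hn2 : A₂ ∉ polysIn L := IsCentralizerBasis.notMem hA (i := 2) (by decide)
  -- `A₁` is only an auxiliary choice for the rank computation; the resulting `φ` serves every `g`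
  -- at once.
  obtain ⟨φ, hφ⟩ := exists_common_right_factor (K := SpectralField L A₁ A₂) h hord hτ hker
    (b := MvPolynomial.X 1) (by rwa [hX1])
  simp only [← map_shiftOp] at hφ
  have hL : shiftOpΓ L A₁ A₂ L (MvPolynomial.X 0) ∈ Ideal.span {D _ + const φ} := by
    have := hφ (MvPolynomial.X 0)
    rwa [evalOps_X h, MvPolynomial.map_X] at this
  refine ⟨φ, rightDvd_iff.mpr hL, ?_, ?_, ?_⟩
  · have h1 := hφ (MvPolynomial.X 1)
    have h2 := hφ (MvPolynomial.X 2)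
    have h3 := (subres_shiftOp h hord hτ hker (b := MvPolynomial.X 1) (by rwa [hX1]) hφ).1
    rw [hX1, MvPolynomial.map_X] at h1 h3
    rw [hX2, MvPolynomial.map_X] at h2
    -- Already `L - λ` and `A₁ - μ₁` generate `∂ + φ`, and the third operator is a left multiple of
    -- it.
    refine isGCRD_of_mem_span ?_ (Ideal.span_mono ?_ h3)
    · rintro P (rfl | rfl | rfl)
      exacts [hL, h1, h2]
    · rintro P (rfl | rfl)
      exacts [Or.inl rfl, Or.inr (Or.inl rfl)]
  · rintro B₁ B₂ hB g₁ g₂ rfl rfl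
    have h3 := (subres_shiftOp h hord hτ hker (b := g₁)
      (IsCentralizerBasis.notMem hB (i := 1) (by decide)) hφ).1
    refine isGCRD_of_mem_span ?_ (Ideal.span_mono ?_ h3)
    · rintro P (rfl | rfl | rfl)
      exacts [hL, hφ g₁, hφ g₂]
    · rintro P (rfl | rfl)
      exacts [Or.inl rfl, Or.inr (Or.inl rfl)]
  · have key : ∀ b : MvPolynomial (Fin 3) (constants F), evalOps L A₁ A₂ b ∉ polysIn L → _ :=
      fun b hb => And.intro (hφ b) (subres_shiftOp h hord hτ hker hb hφ)
    have hgcrd : ∀ A μ, D _ + const φ ∈ Ideal.span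
        {shiftOpΓ L A₁ A₂ L (MvPolynomial.X 0), shiftOpΓ L A₁ A₂ A μ} →
        shiftOpΓ L A₁ A₂ A μ ∈ Ideal.span {D _ + const φ} →
        IsGCRD {shiftOpΓ L A₁ A₂ L (MvPolynomial.X 0), shiftOpΓ L A₁ A₂ A μ}
          (D _ + const φ) := by
      intro A μ h1 h2
      refine isGCRD_of_mem_span ?_ h1
      rintro P (rfl | rfl)
      exacts [hL, h2]
    rintro A μ (⟨rfl, rfl⟩ | ⟨rfl, rfl⟩)
    · have := key (MvPolynomial.X 1) (by rwa [hX1])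
      rw [hX1, MvPolynomial.map_X] at this
      exact ⟨hgcrd _ _ this.2.1 this.1, this.2.2⟩
    · have := key (MvPolynomial.X 2) (by rwa [hX2])
      rw [hX2, MvPolynomial.map_X] at this
      exact ⟨hgcrd _ _ this.2.1 this.1, this.2.2⟩

end
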